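/- Notation. For $e\ge 1$ and ${\bf a}=(a_1,\dots,a_e)\in\mathbb{Z}_{\ge 0}^e$ write $|{\bf a}|=a_1+\cdots+a_e$ and ${\bf a}\cdot\mathbb{N}=a_1+2a_2+\cdots+ea_e$. For $n\ge 0$ and $i,j\ge 0$ define polynomials in $x_1,\dots,x_e$ by $$g_{n,e}=\frac{1}{n+1}\sum_{{\bf a}\cdot\mathbb{N}=n}(-1)^{|{\bf a}|}\binom{n+|{\bf a}|}{{\bf a},\,n}x_1^{a_1}\cdots x_e^{a_e},\qquad \alpha_{i,j,e}=\sum_{{\bf a}\cdot\mathbb{N}=j-i}(-1)^{|{\bf a}|}\binom{|{\bf a}|+j+2}{{\bf a},\,j+2}x_1^{a_1}\cdots x_e^{a_e}$$ (multinomial coefficients; the empty sum is $0$), and for $d\ge 2$ let $$a_{d,e}=\det\left(\alpha_{i,j,e}\ \middle|\ 0\le i\le e-1,\ d-1\le j\le d+e-2\right).$$ Let $\mathcal{G}$ be the group of polynomial automorphisms of the complex affine plane, under composition. Let $\mathcal{A}\subset\mathcal{G}$ be the subgroup of automorphisms of degree one, and $\mathcal{B}\subset\mathcal{G}$ the subgroup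 of automorphisms $(aX+P(Y),\,bY+c)$ with $a,b\in\mathbb{C}^*$, $c\in\mathbb{C}$, $P\in\mathbb{C}[Y]$. Let $\mathcal{G}_{(d_1,\dots,d_k)}$ be the set of automorphisms of polydegree $(d_1,\dots,d_k)$, that is, of all $\theta=\alpha_0\tau_1\alpha_1\cdots\tau_k\alpha_k$ with $\alpha_0,\dots,\alpha_k\in\mathcal{A}$, $\alpha_i\notin\mathcal{B}$ for $1\le i\le k-1$, and $\tau_i\in\mathcal{B}\setminus\mathcal{A}$ with $\deg\tau_i=d_i$. Closures are taken in the Zariski topology of the ind-variety $\mathcal{G}$: a subset $C\subset\mathcal{G}$ is closed if, for every $n$, the set of elements of $C$ of degree at most $n$ is defined by polynomial equations in the coefficients inside the set of elements of $\mathcal{G}$ of degree at most $n$. Theorem. Let $d\ge 2$ and $e\ge 1$, and suppose that there exists a $\mathbb{C}$-algebra homomorphism $\psi:\mathbb{C}[x_1,\dots,x_e]\to\mathbb{C}$ such that 1. $\psi(g_{d+i,e})=0$ for each $0\le i\le e-2$; 2. $\psi(g_{d+e-1,e})\ne 0$; and 3. $\psi(a_{d,e})\ne 0$. Then $\mathcal{G}_{(d+e)}\subset\overline{\mathcal{G}_{(d,e+1)}}$.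 -/

import Mathlib

/-! ### Polynomial endomorphisms and automorphisms of the affine plane -/

/-- A polynomial endomorphism `(F₀, F₁)` of the affine plane over `R`, with `F₀, F₁ ∈ R[X, Y]`.
The variables `X` and `Y` are `MvPolynomial.X 0` and `MvPolynomial.X 1`. -/
@[ext]
structure PolyEnd (R : Type*) [CommRing R] where
  /-- The two components. -/
  coord : Fin 2 → MvPolynomial (Fin 2) R

/-- Polynomial endomorphisms form a monoid under composition of maps:
`F * G` is `F ∘ G = (F₀(G₀, G₁), F₁(G₀, G₁))`, and `1 = (X, Y)`. -/
noncomputable instance PolyEnd.instMonoid (R : Type*) [CommRing R] : Monoid (PolyEnd R) where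
  one := ⟨fun i => MvPolynomial.X i⟩
  mul F G := ⟨fun i => MvPolynomial.bind₁ G.coord (F.coord i)⟩
  one_mul F := by
    apply PolyEnd.ext
    funext i
    exact MvPolynomial.bind₁_X_right F.coord i
  mul_one F := by
    apply PolyEnd.ext
    funext i
    change MvPolynomial.bind₁ MvPolynomial.X (F.coord i) = F.coord i
    rw [MvPolynomial.bind₁_X_left]
    rfl
  mul_assoc F G H := by
    apply PolyEnd.ext
    funext i
    exact MvPolynomial.bind₁_bind₁ G.coord H.coord (F.coord i)

/-- The group of polynomial automorphisms of the affine plane over `R`: the endomorphisms that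
have a polynomial inverse, under composition. -/
def PlaneAut (R : Type*) [CommRing R] : Type _ := (PolyEnd R)ˣ

noncomputable instance PlaneAut.instGroup (R : Type*) [CommRing R] : Group (PlaneAut R) :=
  inferInstanceAs (Group (PolyEnd R)ˣ)

/-- The components of an automorphism. -/
def PlaneAut.coord {R : Type*} [CommRing R] (θ : PlaneAut R) :
    Fin 2 → MvPolynomial (Fin 2) R :=
  (Units.val (α := PolyEnd R) θ).coord

/-- The degree of an automorphism: the larger of the total degrees of its components. -/
def PlaneAut.degree {R : Type*} [CommRing R] (θ : PlaneAut R) : ℕ :=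
  max (θ.coord 0).totalDegree (θ.coord 1).totalDegree

/-- The affine automorphisms: those of degree one. -/
def affineAuts (K : Type*) [Field K] : Set (PlaneAut K) :=
  {θ | θ.degree = 1}

/-- The (upper) triangular automorphisms `(aX + P(Y), bY + c)`, with `a, b ≠ 0`. -/
def triangularAuts (K : Type*) [Field K] : Set (PlaneAut K) :=
  {θ | ∃ (a b c : K) (P : Polynomial K), a ≠ 0 ∧ b ≠ 0 ∧
    θ.coord 0 = MvPolynomial.C a * MvPolynomial.X 0 + Polynomial.aeval (MvPolynomial.X 1) P ∧
    θ.coord 1 = MvPolynomial.C b * MvPolynomial.X 1 + MvPolynomial.C c}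

/-- The set of automorphisms of polydegree `(δ₁, …, δₖ)`: those with a reduced factorization
`θ = α₀ τ₁ α₁ ⋯ τₖ αₖ` in which every `αᵢ` is affine, the inner ones `α₁, …, αₖ₋₁` are not
triangular, and every `τᵢ` is triangular, not affine, and of degree `δᵢ`. -/
def polydegreeSet (K : Type*) [Field K] {k : ℕ} (δ : Fin k → ℕ) : Set (PlaneAut K) :=
  {θ | ∃ (α : Fin (k + 1) → PlaneAut K) (τ : Fin k → PlaneAut K),
    (∀ i, α i ∈ affineAuts K) ∧
    (∀ i, i ≠ 0 → i ≠ Fin.last k → α i ∉ triangularAuts K) ∧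
    (∀ i, τ i ∈ triangularAuts K ∧ τ i ∉ affineAuts K ∧ (τ i).degree = δ i) ∧
    θ = α 0 * (List.ofFn fun i : Fin k => τ i * α i.succ).prod}

/-! ### The ind-variety topology -/

/-- The coefficients of an automorphism: the value at `(i, m)` is the coefficient of the monomial
with exponent `m` in the `i`-th component. -/
def PlaneAut.coeffs {R : Type*} [CommRing R] (θ : PlaneAut R) :
    Fin 2 × (Fin 2 →₀ ℕ) → R :=
  fun v => (θ.coord v.1).coeff v.2

/-- `C` is closed in the ind-variety of plane automorphisms: for each `n`, the automorphisms of
degree at most `n` that lie in `C` are cut out, among all automorphisms of degree at most `n`,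
by polynomial equations in the coefficients. -/
def IsIndClosed {K : Type*} [Field K] (C : Set (PlaneAut K)) : Prop :=
  ∀ n : ℕ, ∃ S : Set (MvPolynomial (Fin 2 × (Fin 2 →₀ ℕ)) K),
    ∀ θ : PlaneAut K, θ.degree ≤ n →
      (θ ∈ C ↔ ∀ p ∈ S, MvPolynomial.eval θ.coeffs p = 0)

/-- The Zariski topology of the ind-variety of plane automorphisms. -/
instance PlaneAut.instTopologicalSpace (K : Type*) [Field K] : TopologicalSpace (PlaneAut K) :=
  TopologicalSpace.ofClosed {C | IsIndClosed C}
    (by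
      intro n
      refine ⟨{1}, fun θ _ => ?_⟩
      simp)
    (by
      intro A hA n
      have h : ∀ C : A, ∃ S : Set (MvPolynomial (Fin 2 × (Fin 2 →₀ ℕ)) K),
          ∀ θ : PlaneAut K, θ.degree ≤ n →
            (θ ∈ C.1 ↔ ∀ p ∈ S, MvPolynomial.eval θ.coeffs p = 0) :=
        fun C => hA C.2 n
      choose S hS using h
      refine ⟨⋃ C, S C, fun θ hθ => ⟨fun hmem p hp => ?_, fun hp C hC => ?_⟩⟩
      · obtain ⟨C, hC⟩ := Set.mem_iUnion.1 hp
        exact (hS C θ hθ).1 (hmem C.1 C.2) p hC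
      · exact (hS ⟨C, hC⟩ θ hθ).2 fun p h => hp p (Set.mem_iUnion.2 ⟨⟨C, hC⟩, h⟩))
    (by
      intro A hA B hB n
      obtain ⟨S, hS⟩ := hA n
      obtain ⟨T, hT⟩ := hB n
      refine ⟨{r | ∃ p ∈ S, ∃ q ∈ T, r = p * q}, fun θ hθ => ⟨?_, fun h => ?_⟩⟩
      · rintro (h | h) r ⟨p, hp, q, hq, rfl⟩
        · rw [map_mul, (hS θ hθ).1 h p hp, zero_mul]
        · rw [map_mul, (hT θ hθ).1 h q hq, mul_zero]
      · by_cases hA' : θ ∈ A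
        · exact Or.inl hA'
        · right
          rw [hS θ hθ] at hA'
          push Not at hA'
          obtain ⟨p, hp, hp0⟩ := hA'
          refine (hT θ hθ).2 fun q hq => ?_
          have := h (p * q) ⟨p, hp, q, hq, rfl⟩
          rw [map_mul] at this
          exact (mul_eq_zero.1 this).resolve_left hp0)

theorem PlaneAut.isClosed_iff {K : Type*} [Field K] (C : Set (PlaneAut K)) :
    IsClosed C ↔ IsIndClosed C :=
  by rw [← isOpen_compl_iff]; exact iff_of_eq (congrArg IsIndClosed (compl_compl C))

/-! ### The polynomials `α_{i,j,e}`, `g_{n,e}` and `a_{d,e}` -/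

/-- The exponent vectors `(a₁, …, aₑ)` with `a₁ + 2 a₂ + ⋯ + e aₑ = n`; the entry `aₖ₊₁` is
`a k` for `k : Fin e`. -/
def weightedExponents (e n : ℕ) : Finset (Fin e → ℕ) :=
  (Fintype.piFinset fun _ => Finset.range (n + 1)).filter
    fun a => ∑ k : Fin e, ((k : ℕ) + 1) * a k = n

/-- The bound on the entries in `weightedExponents` excludes nothing. -/
theorem mem_weightedExponents {e n : ℕ} {a : Fin e → ℕ} :
    a ∈ weightedExponents e n ↔ ∑ k : Fin e, ((k : ℕ) + 1) * a k = n := by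
  simp only [weightedExponents, Finset.mem_filter, Fintype.mem_piFinset, Finset.mem_range,
    and_iff_right_iff_imp]
  intro h k
  have h1 : ((k : ℕ) + 1) * a k ≤ n := by
    rw [← h]
    exact Finset.single_le_sum (f := fun k : Fin e => ((k : ℕ) + 1) * a k)
      (fun _ _ => Nat.zero_le _) (Finset.mem_univ k)
  nlinarith [Nat.zero_le ((k : ℕ) * a k)]

/-- The sum over `a₁ + 2 a₂ + ⋯ + e aₑ = n` of
`(-1)^|a| * multinomial(|a| + m; a₁, …, aₑ, m) * x₁ ^ a₁ ⋯ xₑ ^ aₑ`. The variable `xₖ₊₁` is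
`MvPolynomial.X k` for `k : Fin e`. -/
noncomputable def multinomialSum (R : Type*) [CommRing R] (e n m : ℕ) : MvPolynomial (Fin e) R :=
  ∑ a ∈ weightedExponents e n,
    MvPolynomial.C ((-1 : R) ^ (∑ k, a k) *
      (Nat.multinomial Finset.univ (Fin.cons m a : Fin (e + 1) → ℕ) : R)) *
      ∏ k, MvPolynomial.X k ^ a k

/-- The polynomial `g_{n,e}`. -/
noncomputable def gPoly (K : Type*) [Field K] (n e : ℕ) : MvPolynomial (Fin e) K :=
  MvPolynomial.C (1 / ((n : K) + 1)) * multinomialSum K e n n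

/-- The polynomial `α_{i,j,e}`, for `i, j ≥ 0`; it is `0` if `j < i`, because `j - i` is then not
a value of `a₁ + 2 a₂ + ⋯ + e aₑ`. -/
noncomputable def alphaPoly (R : Type*) [CommRing R] (i j e : ℕ) : MvPolynomial (Fin e) R :=
  if i ≤ j then multinomialSum R e (j - i) (j + 2) else 0

/-- The determinant `a_{d,e}` of the matrix of the `α_{i,j,e}` with rows `0 ≤ i ≤ e - 1` and
columns `d - 1 ≤ j ≤ d + e - 2`. -/
noncomputable def aPoly (R : Type*) [CommRing R] (d e : ℕ) : MvPolynomial (Fin e) R :=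
  Matrix.det (Matrix.of fun i j : Fin e => alphaPoly R (i : ℕ) (d - 1 + (j : ℕ)) e)

/-! Put `N = d + e`. Composing with affine maps and rescaling, an automorphism of polydegree `(N)`
becomes `(-X + P(Y), Y)` with `P(0) = 0`, `deg P ≤ N` and any prescribed nonzero coefficient in
degree `N`; the choice made is `ψ(g_{N-1})`. This automorphism is obtained as a limit for `t → 0` of
`(t⁻ᴺ X, t⁻¹ Y) ∘ (X - G(Y), Y) ∘ (Y, X) ∘ (X + f(Y), Y) ∘ (tᴺ X, t Y)`, where `f = z + x₁ z² + ⋯ +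
xₑ z^(e+1)` and `G = b₁ z + ⋯ + b_d z^d` depend on `t`. The components are `t⁻ᴺ (tY - G(tᴺ X +
f(tY)))` and `t⁻¹ (tᴺ X + f(tY))`. If the parameters converge with `b₁ → 1`, and `G(f(z)) ≡ z - tᴺ
P(z/t)` modulo `z^(N+1)`, the limit is `(P(Y) - X, Y)` (`coeffTendsto_regular`).

The congruence is a system of `N` equations in the `N` unknowns `(x, b)`, with right-hand sides
polynomial in `t`. At `t = 0` it reads `G(f(z)) ≡ z - g_{N-1} z^N`. By Lagrange inversion the values
`ψ(g_n)` are the coefficients of `z^(n+1)` in the compositional inverse of `f` with `xₖ = ψ(xₖ)`.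
Since those for `d ≤ n ≤ N - 2` vanish, truncating the inverse at degree `d` gives a solution
(`PowerSeries.X_pow_dvd_sum_sub`).

The inverse function theorem extends this solution to small `t`. A residue computation reduces
injectivity of the Jacobian to the nonvanishing of `ψ(a_{d,e})`
(`PowerSeries.eq_zero_of_X_pow_dvd_sum`, `PowerSeries.exists_tendsto_compCoeffs_eq`). Leading
coefficients of `f` or `G` may vanish along the solution, so members of the family are only known to
lie in the closure of the polydegree `(d, e+1)` set (`mul_familyAut_mul_mem_closure`); this is
enough, because a closure is closed under such limits. -/

open Filter Topology

/-! ### Coefficientwise limits and the ind-topology -/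

/-- Coefficientwise convergence of a family of polynomials of bounded degree. -/
def CoeffTendsto {ι : Type*} (l : Filter ι) (p : ι → MvPolynomial (Fin 2) ℂ)
    (q : MvPolynomial (Fin 2) ℂ) : Prop :=
  (∃ D : ℕ, ∀ i, (p i).totalDegree ≤ D) ∧
    ∀ m, Tendsto (fun i => (p i).coeff m) l (𝓝 (q.coeff m))

namespace CoeffTendsto

variable {ι : Type*} {l : Filter ι} {p p' : ι → MvPolynomial (Fin 2) ℂ}
  {q q' : MvPolynomial (Fin 2) ℂ}

theorem const (q : MvPolynomial (Fin 2) ℂ) : CoeffTendsto l (fun _ => q) q :=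
  ⟨⟨q.totalDegree, fun _ => le_rfl⟩, fun _ => tendsto_const_nhds⟩

theorem C {c : ι → ℂ} {a : ℂ} (h : Tendsto c l (𝓝 a)) :
    CoeffTendsto l (fun i => MvPolynomial.C (c i)) (MvPolynomial.C a) := by
  refine ⟨⟨0, fun i => by simp⟩, fun m => ?_⟩
  simp only [MvPolynomial.coeff_C]
  split_ifs
  · exact h
  · exact tendsto_const_nhds

theorem add (h : CoeffTendsto l p q) (h' : CoeffTendsto l p' q') :
    CoeffTendsto l (fun i => p i + p' i) (q + q') := by
  obtain ⟨⟨D, hD⟩, hc⟩ := h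
  obtain ⟨⟨D', hD'⟩, hc'⟩ := h'
  refine ⟨⟨max D D', fun i => (MvPolynomial.totalDegree_add _ _).trans
    (max_le_max (hD i) (hD' i))⟩, fun m => ?_⟩
  simpa using (hc m).add (hc' m)

theorem mul (h : CoeffTendsto l p q) (h' : CoeffTendsto l p' q') :
    CoeffTendsto l (fun i => p i * p' i) (q * q') := by
  obtain ⟨⟨D, hD⟩, hc⟩ := h
  obtain ⟨⟨D', hD'⟩, hc'⟩ := h'
  refine ⟨⟨D + D', fun i => (MvPolynomial.totalDegree_mul _ _).trans
    (add_le_add (hD i) (hD' i))⟩, fun m => ?_⟩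
  simp only [MvPolynomial.coeff_mul]
  exact tendsto_finsetSum _ fun x _ => (hc _).mul (hc' _)

theorem neg (h : CoeffTendsto l p q) : CoeffTendsto l (fun i => -p i) (-q) := by
  simpa using (const (l := l) (-1 : MvPolynomial (Fin 2) ℂ)).mul h

theorem sub (h : CoeffTendsto l p q) (h' : CoeffTendsto l p' q') :
    CoeffTendsto l (fun i => p i - p' i) (q - q') := by
  simpa [sub_eq_add_neg] using h.add h'.neg

theorem pow (h : CoeffTendsto l p q) (n : ℕ) : CoeffTendsto l (fun i => p i ^ n) (q ^ n) := by
  induction n with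
  | zero => simpa using const (l := l) (1 : MvPolynomial (Fin 2) ℂ)
  | succ n ih => simpa only [pow_succ] using ih.mul h

theorem sum {κ : Type*} (s : Finset κ) {p : κ → ι → MvPolynomial (Fin 2) ℂ}
    {q : κ → MvPolynomial (Fin 2) ℂ} (h : ∀ k ∈ s, CoeffTendsto l (p k) (q k)) :
    CoeffTendsto l (fun i => ∑ k ∈ s, p k i) (∑ k ∈ s, q k) := by
  classical
  induction s using Finset.induction_on with
  | empty => simpa using const (l := l) (0 : MvPolynomial (Fin 2) ℂ)
  | insert a s ha ih =>
    simp only [Finset.sum_insert ha]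
    exact (h a (by simp)).add (ih fun k hk => h k (by simp [hk]))

theorem prod {κ : Type*} (s : Finset κ) {p : κ → ι → MvPolynomial (Fin 2) ℂ}
    {q : κ → MvPolynomial (Fin 2) ℂ} (h : ∀ k ∈ s, CoeffTendsto l (p k) (q k)) :
    CoeffTendsto l (fun i => ∏ k ∈ s, p k i) (∏ k ∈ s, q k) := by
  classical
  induction s using Finset.induction_on with
  | empty => simpa using const (l := l) (1 : MvPolynomial (Fin 2) ℂ)
  | insert a s ha ih =>
    simp only [Finset.prod_insert ha]
    exact (h a (by simp)).mul (ih fun k hk => h k (by simp [hk]))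

theorem exists_totalDegree_le_max (h : CoeffTendsto l p q) :
    ∃ D : ℕ, (∀ i, (p i).totalDegree ≤ D) ∧ q.totalDegree ≤ D := by
  obtain ⟨D, hD⟩ := h.1
  exact ⟨max D q.totalDegree, fun i => (hD i).trans (le_max_left _ _), le_max_right _ _⟩

end CoeffTendsto

/-- The index set depends only on the degree bound, so a whole family of bounded degree is expanded
over one fixed finite sum, in which limits can be taken term by term. -/
theorem MvPolynomial.eq_sum_Iic_of_totalDegree_le {σ R : Type*} [Fintype σ] [CommSemiring R]
    [DecidableEq σ] {p : MvPolynomial σ R} {D : ℕ} (h : p.totalDegree ≤ D) :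
    p = ∑ m ∈ Finset.Iic (Finsupp.equivFunOnFinite.symm fun _ : σ => D),
      MvPolynomial.monomial m (p.coeff m) := by
  conv_lhs => rw [p.as_sum]
  refine Finset.sum_subset (fun m hm => ?_) fun m _ hm => ?_
  · rw [Finset.mem_Iic]
    intro i
    have hm' : m.degree ≤ p.totalDegree := MvPolynomial.le_totalDegree hm
    exact ((Finsupp.le_degree i m).trans hm').trans h
  · rw [MvPolynomial.notMem_support_iff.1 hm, map_zero]

namespace CoeffTendsto

variable {ι : Type*} {l : Filter ι} {p : ι → MvPolynomial (Fin 2) ℂ}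
  {q : MvPolynomial (Fin 2) ℂ}

theorem bind₁ {P : ι → Fin 2 → MvPolynomial (Fin 2) ℂ} {Q : Fin 2 → MvPolynomial (Fin 2) ℂ}
    (h : CoeffTendsto l p q) (hP : ∀ k, CoeffTendsto l (fun i => P i k) (Q k)) :
    CoeffTendsto l (fun i => MvPolynomial.bind₁ (P i) (p i)) (MvPolynomial.bind₁ Q q) := by
  obtain ⟨D, hD, hq⟩ := h.exists_totalDegree_le_max
  have key : ∀ (R : Fin 2 → MvPolynomial (Fin 2) ℂ) (r : MvPolynomial (Fin 2) ℂ),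
      r.totalDegree ≤ D → MvPolynomial.bind₁ R r =
        ∑ m ∈ Finset.Iic (Finsupp.equivFunOnFinite.symm fun _ : Fin 2 => D),
          MvPolynomial.C (r.coeff m) * ∏ k, R k ^ m k := by
    intro R r hr
    conv_lhs => rw [MvPolynomial.eq_sum_Iic_of_totalDegree_le hr]
    simp only [map_sum, MvPolynomial.bind₁_monomial]
    refine Finset.sum_congr rfl fun m _ => ?_
    rw [Finset.prod_subset (Finset.subset_univ m.support) fun k _ hk => by
      simp [Finsupp.notMem_support_iff.1 hk]]
  simp only [key Q q hq, fun i => key (P i) (p i) (hD i)]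
  exact sum _ fun m _ => (C (h.2 m)).mul (prod _ fun k _ => (hP k).pow _)

end CoeffTendsto

/-- A coefficientwise limit of elements of `S` of bounded degree lies in the closure of `S`. -/
theorem PlaneAut.mem_closure_of_coeffTendsto {ι : Type*} {l : Filter ι} [l.NeBot]
    {S : Set (PlaneAut ℂ)} {θ : PlaneAut ℂ} {P : ι → Fin 2 → MvPolynomial (Fin 2) ℂ}
    (hP : ∀ k, CoeffTendsto l (fun i => P i k) (θ.coord k))
    (hS : ∀ᶠ i in l, ∃ η ∈ S, η.coord = P i) : θ ∈ closure S := by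
  obtain ⟨D₀, h₀, h₀'⟩ := (hP 0).exists_totalDegree_le_max
  obtain ⟨D₁, h₁, h₁'⟩ := (hP 1).exists_totalDegree_le_max
  -- One degree bound serves for the family and its limit, so a single system of polynomial
  -- equations describes membership in the closure for all of them.
  obtain ⟨E, hE⟩ := (PlaneAut.isClosed_iff _).1 (isClosed_closure (s := S)) (max D₀ D₁)
  refine (hE θ (max_le_max h₀' h₁')).2 fun f hf => ?_
  -- Each equation is continuous in the coefficients for the product topology, and it vanishes along
  -- the family.
  have hlim : Tendsto (fun i => MvPolynomial.eval (fun v : Fin 2 × (Fin 2 →₀ ℕ) =>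
      (P i v.1).coeff v.2) f) l (𝓝 (MvPolynomial.eval θ.coeffs f)) :=
    ((MvPolynomial.continuous_eval f).tendsto θ.coeffs).comp
      (tendsto_pi_nhds.2 fun v => (hP v.1).2 v.2)
  refine tendsto_nhds_unique hlim (tendsto_const_nhds.congr' ?_)
  filter_upwards [hS] with i ⟨η, hη, hi⟩
  have := (hE η (by
    rw [PlaneAut.degree, hi]
    exact max_le_max (h₀ i) (h₁ i))).1 (subset_closure hη) f hf
  rw [← this, ← hi]
  rfl

/-! ### Affine and triangular automorphisms -/

namespace PlaneAut

variable {K : Type*} [Field K]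

@[ext]
theorem ext {R : Type*} [CommRing R] {θ η : PlaneAut R} (h : ∀ i, θ.coord i = η.coord i) :
    θ = η :=
  Units.ext (PolyEnd.ext (funext h))

theorem coord_one {R : Type*} [CommRing R] (i : Fin 2) :
    (1 : PlaneAut R).coord i = MvPolynomial.X i :=
  rfl

theorem coord_mul {R : Type*} [CommRing R] (θ η : PlaneAut R) (i : Fin 2) :
    (θ * η).coord i = MvPolynomial.bind₁ η.coord (θ.coord i) :=
  rfl

end PlaneAut

theorem MvPolynomial.totalDegree_bind₁_le {σ τ R : Type*} [CommSemiring R]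
    {f : σ → MvPolynomial τ R} {p : MvPolynomial σ R} {m n : ℕ} (hp : p.totalDegree ≤ n)
    (hf : ∀ i, (f i).totalDegree ≤ m) : (MvPolynomial.bind₁ f p).totalDegree ≤ n * m := by
  conv_lhs => rw [p.as_sum]
  simp only [map_sum, MvPolynomial.bind₁_monomial]
  refine MvPolynomial.totalDegree_finsetSum_le fun s hs => ?_
  refine (MvPolynomial.totalDegree_mul _ _).trans ?_
  rw [MvPolynomial.totalDegree_C, zero_add]
  refine (MvPolynomial.totalDegree_finsetProd _ _).trans ?_
  calc ∑ i ∈ s.support, (f i ^ s i).totalDegree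
      ≤ ∑ i ∈ s.support, s i * m := Finset.sum_le_sum fun i _ =>
        (MvPolynomial.totalDegree_pow _ _).trans (Nat.mul_le_mul_left _ (hf i))
    _ = (s.sum fun _ k => k) * m := by rw [← Finset.sum_mul]; rfl
    _ ≤ n * m := Nat.mul_le_mul_right _ ((MvPolynomial.le_totalDegree hs).trans hp)

namespace PlaneAut

variable {K : Type*} [Field K]

theorem totalDegree_coord_le (θ : PlaneAut K) (i : Fin 2) :
    (θ.coord i).totalDegree ≤ θ.degree := by
  fin_cases i
  · exact le_max_left _ _
  · exact le_max_right _ _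

/-- The identity `θ⁻¹ ∘ θ` has degree one, and degrees are submultiplicative under composition. As
affine means degree exactly one, closure of the affine maps under products needs this lower bound.
-/
theorem one_le_degree (θ : PlaneAut K) : 1 ≤ θ.degree := by
  have h : (θ⁻¹ * θ).coord 0 = MvPolynomial.X 0 := by rw [inv_mul_cancel, coord_one]
  rw [coord_mul] at h
  have h' := MvPolynomial.totalDegree_bind₁_le (θ⁻¹.totalDegree_coord_le 0) θ.totalDegree_coord_le
  rw [h, MvPolynomial.totalDegree_X] at h'
  exact Nat.pos_of_ne_zero fun h0 => by simp [h0] at h'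

theorem mul_mem_affineAuts {θ η : PlaneAut K} (hθ : θ ∈ affineAuts K) (hη : η ∈ affineAuts K) :
    θ * η ∈ affineAuts K := by
  have h : ∀ i, ((θ * η).coord i).totalDegree ≤ 1 := fun i => by
    rw [coord_mul]
    exact MvPolynomial.totalDegree_bind₁_le (m := 1) (n := 1)
      ((θ.totalDegree_coord_le i).trans_eq hθ)
      fun j => (η.totalDegree_coord_le j).trans_eq hη
  exact le_antisymm (max_le (h 0) (h 1)) (one_le_degree _)

end PlaneAut

/-- The triangular endomorphism `(aX + P(Y), bY + c)`. -/
noncomputable def PolyEnd.triangular {R : Type*} [CommRing R] (a b c : R) (P : Polynomial R) :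
    PolyEnd R :=
  ⟨![MvPolynomial.C a * MvPolynomial.X 0 + Polynomial.aeval (MvPolynomial.X 1) P,
    MvPolynomial.C b * MvPolynomial.X 1 + MvPolynomial.C c]⟩

theorem PolyEnd.triangular_mul {R : Type*} [CommRing R] (a b c a' b' c' : R)
    (P P' : Polynomial R) :
    PolyEnd.triangular a b c P * PolyEnd.triangular a' b' c' P' =
      PolyEnd.triangular (a * a') (b * b') (b * c' + c) (Polynomial.C a * P' +
        P.comp (Polynomial.C b' * Polynomial.X + Polynomial.C c')) := by
  apply PolyEnd.ext
  funext i
  change MvPolynomial.bind₁ (PolyEnd.triangular a' b' c' P').coord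
    ((PolyEnd.triangular a b c P).coord i) = _
  fin_cases i
  · simp [PolyEnd.triangular, ← Polynomial.aeval_algHom_apply, Polynomial.aeval_comp,
      MvPolynomial.algebraMap_eq]
    ring
  · simp [PolyEnd.triangular]
    ring

theorem PolyEnd.triangular_one {R : Type*} [CommRing R] :
    PolyEnd.triangular (1 : R) 1 0 0 = 1 := by
  apply PolyEnd.ext
  funext i
  change _ = MvPolynomial.X i
  fin_cases i <;> simp [PolyEnd.triangular]

/-- The swap `(Y, X)`. -/
noncomputable def PlaneAut.swap (R : Type*) [CommRing R] : PlaneAut R :=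
  have h : (⟨![MvPolynomial.X 1, MvPolynomial.X 0]⟩ * ⟨![MvPolynomial.X 1, MvPolynomial.X 0]⟩ :
      PolyEnd R) = 1 := by
    apply PolyEnd.ext
    funext i
    change MvPolynomial.bind₁ _ _ = MvPolynomial.X i
    fin_cases i <;> simp
  (⟨_, _, h, h⟩ : (PolyEnd R)ˣ)

namespace PlaneAut

variable {K : Type*} [Field K]

/-- The triangular automorphism `(aX + P(Y), bY + c)`. -/
noncomputable def triangular {a b : K} (ha : a ≠ 0) (hb : b ≠ 0) (c : K) (P : Polynomial K) :
    PlaneAut K :=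
  (⟨PolyEnd.triangular a b c P,
    PolyEnd.triangular a⁻¹ b⁻¹ (-(b⁻¹ * c)) (-(Polynomial.C a⁻¹ *
      P.comp (Polynomial.C b⁻¹ * Polynomial.X + Polynomial.C (-(b⁻¹ * c))))),
    by
      rw [PolyEnd.triangular_mul, ← PolyEnd.triangular_one]
      congr 1
      · field_simp
      · field_simp
      · field_simp; ring
      · rw [mul_neg, ← mul_assoc, ← Polynomial.C_mul, mul_inv_cancel₀ ha]
        simp,
    by
      rw [PolyEnd.triangular_mul, ← PolyEnd.triangular_one]
      congr 1
      · field_simp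
      · field_simp
      · field_simp; ring
      · rw [Polynomial.neg_comp, Polynomial.mul_comp, Polynomial.C_comp, Polynomial.comp_assoc]
        have : (Polynomial.C b⁻¹ * Polynomial.X + Polynomial.C (-(b⁻¹ * c))).comp
            (Polynomial.C b * Polynomial.X + Polynomial.C c) = Polynomial.X := by
          simp only [Polynomial.add_comp, Polynomial.mul_comp, Polynomial.C_comp,
            Polynomial.X_comp, mul_add, ← mul_assoc, ← Polynomial.C_mul, inv_mul_cancel₀ hb,
            Polynomial.C_neg]
          simp
        rw [this]
        simp⟩ : (PolyEnd K)ˣ)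

theorem triangular_coord {a b : K} (ha : a ≠ 0) (hb : b ≠ 0) (c : K) (P : Polynomial K) :
    (triangular ha hb c P).coord =
      ![MvPolynomial.C a * MvPolynomial.X 0 + Polynomial.aeval (MvPolynomial.X 1) P,
        MvPolynomial.C b * MvPolynomial.X 1 + MvPolynomial.C c] :=
  rfl

theorem swap_coord : (swap K).coord = ![MvPolynomial.X 1, MvPolynomial.X 0] :=
  rfl

theorem triangular_mul {a b a' b' : K} (ha : a ≠ 0) (hb : b ≠ 0) (ha' : a' ≠ 0) (hb' : b' ≠ 0)
    (c c' : K) (P P' : Polynomial K) :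
    triangular ha hb c P * triangular ha' hb' c' P' =
      triangular (mul_ne_zero ha ha') (mul_ne_zero hb hb') (b * c' + c) (Polynomial.C a * P' +
        P.comp (Polynomial.C b' * Polynomial.X + Polynomial.C c')) :=
  Units.ext (PolyEnd.triangular_mul a b c a' b' c' P P')

theorem triangular_mem {a b : K} (ha : a ≠ 0) (hb : b ≠ 0) (c : K) (P : Polynomial K) :
    triangular ha hb c P ∈ triangularAuts K :=
  ⟨a, b, c, P, ha, hb, rfl, rfl⟩

theorem exists_eq_triangular {θ : PlaneAut K} (h : θ ∈ triangularAuts K) :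
    ∃ (a b c : K) (ha : a ≠ 0) (hb : b ≠ 0) (P : Polynomial K), θ = triangular ha hb c P := by
  obtain ⟨a, b, c, P, ha, hb, h0, h1⟩ := h
  refine ⟨a, b, c, ha, hb, P, PlaneAut.ext fun i => ?_⟩
  fin_cases i
  · exact h0
  · exact h1

theorem coeff_aeval_X (i : Fin 2) (P : Polynomial K) (n : ℕ) :
    (Polynomial.aeval (MvPolynomial.X i : MvPolynomial (Fin 2) K) P).coeff
      (Finsupp.single i n) = P.coeff n := by
  rw [Polynomial.aeval_eq_sum_range, MvPolynomial.coeff_sum]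
  simp only [MvPolynomial.coeff_smul, MvPolynomial.coeff_X_pow, smul_eq_mul,
    (Finsupp.single_injective i).eq_iff, mul_ite, mul_one, mul_zero, Finset.sum_ite_eq',
    Finset.mem_range]
  split_ifs with h
  · rfl
  · exact (Polynomial.coeff_eq_zero_of_natDegree_lt (by omega)).symm

theorem degree_triangular {a b : K} (ha : a ≠ 0) (hb : b ≠ 0) (c : K) (P : Polynomial K) :
    (triangular ha hb c P).degree = max 1 P.natDegree := by
  have hP : (Polynomial.aeval (MvPolynomial.X 1 : MvPolynomial (Fin 2) K) P).totalDegree ≤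
      P.natDegree := by
    rw [Polynomial.aeval_eq_sum_range]
    refine MvPolynomial.totalDegree_finsetSum_le fun i hi => ?_
    refine (MvPolynomial.totalDegree_smul_le _ _).trans ?_
    rw [MvPolynomial.totalDegree_X_pow]
    exact Nat.lt_succ_iff.1 (Finset.mem_range.1 hi)
  have hlin : ∀ (x : K) (i : Fin 2),
      (MvPolynomial.C x * MvPolynomial.X i : MvPolynomial (Fin 2) K).totalDegree ≤ 1 :=
    fun x i => (MvPolynomial.totalDegree_mul _ _).trans (by simp)
  refine le_antisymm (max_le ?_ ?_) (max_le (one_le_degree _) ?_)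
  · exact (MvPolynomial.totalDegree_add _ _).trans (max_le_max (hlin a 0) hP)
  · refine (MvPolynomial.totalDegree_add _ _).trans (max_le ((hlin b 1).trans (le_max_left _ _)) ?_)
    simp
  · rcases Nat.eq_zero_or_pos P.natDegree with h0 | hpos
    · omega
    · refine le_trans ?_ (totalDegree_coord_le _ 0)
      have hc : ((triangular ha hb c P).coord 0).coeff (Finsupp.single 1 P.natDegree) ≠ 0 := by
        have : (MvPolynomial.C a * MvPolynomial.X 0 : MvPolynomial (Fin 2) K).coeff
            (Finsupp.single 1 P.natDegree) = 0 := by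
          rw [MvPolynomial.coeff_C_mul, MvPolynomial.coeff_X, if_neg, mul_zero]
          intro h
          have := DFunLike.congr_fun h 0
          simp at this
        simp only [triangular_coord, Matrix.cons_val_zero, MvPolynomial.coeff_add, this,
          coeff_aeval_X, zero_add]
        intro h
        rw [Polynomial.coeff_natDegree, Polynomial.leadingCoeff_eq_zero] at h
        simp [h] at hpos
      simpa using MvPolynomial.le_totalDegree (MvPolynomial.mem_support_iff.2 hc)

theorem triangular_mem_affineAuts {a b : K} (ha : a ≠ 0) (hb : b ≠ 0) (c : K) {P : Polynomial K}
    (hP : P.natDegree ≤ 1) : triangular ha hb c P ∈ affineAuts K := by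
  rw [affineAuts, Set.mem_ofPred_eq, degree_triangular, max_eq_left hP]

theorem triangular_notMem_affineAuts {a b : K} (ha : a ≠ 0) (hb : b ≠ 0) (c : K)
    {P : Polynomial K} (hP : 2 ≤ P.natDegree) : triangular ha hb c P ∉ affineAuts K := by
  rw [affineAuts, Set.mem_ofPred_eq, degree_triangular]
  omega

theorem swap_mem_affineAuts : swap K ∈ affineAuts K := by
  simp [affineAuts, degree, swap_coord]

theorem swap_notMem_triangularAuts : swap K ∉ triangularAuts K := by
  rintro ⟨a, b, c, P, ha, hb, h0, h1⟩
  have := congrArg (MvPolynomial.coeff (Finsupp.single 0 1)) h1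
  have h' : (0 : Fin 2 →₀ ℕ) ≠ Finsupp.single 0 1 := fun h => by
    simpa using DFunLike.congr_fun h 0
  have h'' : (Finsupp.single 1 1 : Fin 2 →₀ ℕ) ≠ Finsupp.single 0 1 := fun h => by
    simpa using DFunLike.congr_fun h 0
  simp [swap_coord, MvPolynomial.coeff_X, MvPolynomial.coeff_C, h', h''] at this

/-! ### Normal forms in polydegrees `(m, n)` and `(n)` -/

theorem mul_mem_polydegreeSet {η ζ : PlaneAut K} (hη : η ∈ affineAuts K) (hζ : ζ ∈ affineAuts K)
    {P Q : Polynomial K} {m n : ℕ} (hP : P.natDegree = m) (hQ : Q.natDegree = n) (hm : 2 ≤ m)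
    (hn : 2 ≤ n) :
    η * (triangular one_ne_zero one_ne_zero 0 P * swap K *
      triangular one_ne_zero one_ne_zero 0 Q) * ζ ∈ polydegreeSet K ![m, n] := by
  refine ⟨![η, swap K, ζ], ![triangular (one_ne_zero (α := K)) one_ne_zero 0 P,
    triangular (one_ne_zero (α := K)) one_ne_zero 0 Q], ?_, ?_, ?_, ?_⟩
  · intro i
    fin_cases i
    exacts [hη, swap_mem_affineAuts, hζ]
  · intro i h0 h2
    fin_cases i
    · exact absurd rfl h0
    · exact swap_notMem_triangularAuts
    · exact absurd rfl h2
  · intro i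
    fin_cases i
    · exact ⟨triangular_mem one_ne_zero one_ne_zero _ _,
        triangular_notMem_affineAuts one_ne_zero one_ne_zero _ (hP ▸ hm), by
        simp [degree_triangular, hP]; omega⟩
    · exact ⟨triangular_mem one_ne_zero one_ne_zero _ _,
        triangular_notMem_affineAuts one_ne_zero one_ne_zero _ (hQ ▸ hn), by
        simp [degree_triangular, hQ]; omega⟩
  · simp [List.ofFn_succ, mul_assoc]

/-- Scaling `X` on both sides of a triangular map multiplies its polynomial by an arbitrary nonzero
constant, and a translation removes the constant term. The sign of `X` and the leading coefficient
can thus be adapted to the limit of the degenerating family. -/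
theorem exists_eq_of_mem_polydegreeSet_singleton {n : ℕ} (hn : 2 ≤ n) {θ : PlaneAut K}
    (hθ : θ ∈ polydegreeSet K ![n]) {g : K} (hg : g ≠ 0) :
    ∃ η ∈ affineAuts K, ∃ ζ ∈ affineAuts K, ∃ P : Polynomial K, P.natDegree ≤ n ∧
      P.coeff n = g ∧ P.coeff 0 = 0 ∧
      θ = η * triangular (neg_ne_zero.2 one_ne_zero) one_ne_zero 0 P * ζ := by
  obtain ⟨α, τ, hα, -, hτ, rfl⟩ := hθ
  obtain ⟨ht, -, hd⟩ := hτ 0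
  obtain ⟨a, b, c, ha, hb, P, hP⟩ := exists_eq_triangular ht
  have hPn : P.natDegree = n := by
    rw [hP, degree_triangular] at hd
    simp at hd
    omega
  have hlead : P.coeff n ≠ 0 := by
    rw [← hPn, Polynomial.coeff_natDegree, Ne, Polynomial.leadingCoeff_eq_zero]
    rintro rfl
    simp at hPn
    omega
  -- The left factor rescales by `r` to correct the leading coefficient; the right factor `-a / r`
  -- then restores the coefficient `a` of `X`.
  set r : K := P.coeff n / g with hr
  have hr0 : r ≠ 0 := div_ne_zero hlead hg
  refine ⟨α 0 * triangular hr0 hb c (Polynomial.C (P.coeff 0)),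
    mul_mem_affineAuts (hα 0) (triangular_mem_affineAuts _ _ _ (by simp)),
    triangular (a := -a / r) (div_ne_zero (neg_ne_zero.2 ha) hr0) one_ne_zero 0 0 * α 1,
    mul_mem_affineAuts (triangular_mem_affineAuts _ _ _ (by simp)) (hα 1),
    Polynomial.C r⁻¹ * (P - Polynomial.C (P.coeff 0)), ?_, ?_, ?_, ?_⟩
  · refine (Polynomial.natDegree_C_mul_le _ _).trans ?_
    rw [Polynomial.natDegree_sub_C, hPn]
  · rw [Polynomial.coeff_C_mul, Polynomial.coeff_sub, Polynomial.coeff_C_of_ne_zero (by omega),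
      sub_zero, hr]
    field_simp
  · simp
  · have key : triangular ha hb c P = triangular hr0 hb c (Polynomial.C (P.coeff 0)) *
        (triangular (neg_ne_zero.2 one_ne_zero) one_ne_zero 0
          (Polynomial.C r⁻¹ * (P - Polynomial.C (P.coeff 0))) *
        triangular (a := -a / r) (div_ne_zero (neg_ne_zero.2 ha) hr0) one_ne_zero 0 0) := by
      rw [triangular_mul, triangular_mul]
      congr 1
      · field_simp
      · ring
      · ring
      · simp only [mul_zero, map_zero, map_one, one_mul, add_zero, zero_add, Polynomial.comp_X,
          ← mul_assoc, ← Polynomial.C_mul, mul_inv_cancel₀ hr0]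
        ring
    simp only [List.ofFn_succ, List.ofFn_zero, List.prod_cons, List.prod_nil, hP, key]
    simp [mul_assoc]

end PlaneAut

/-! ### Residues and Lagrange inversion -/

namespace PowerSeries

variable {K : Type*} [Field K]

/-- With `f = X F`, this is the residue of `f' / f^(k+1)`. For `k > 0` that is an exact derivative:
the series equals `F⁻ᵏ - k⁻¹ X (F⁻ᵏ)'`, whose two contributions in degree `k` cancel. Characteristic
zero permits the division by `k`. -/
theorem coeff_inv_pow_mul_derivative_X_mul [CharZero K] {F : K⟦X⟧} (hF : constantCoeff F = 1)
    (k : ℕ) : coeff k (F⁻¹ ^ (k + 1) * derivative K (X * F)) = if k = 0 then 1 else 0 := by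
  have hF0 : constantCoeff F ≠ 0 := by simp [hF]
  have hinv : F⁻¹ * F = 1 := PowerSeries.inv_mul_cancel F hF0
  have hd : derivative K (X * F) = F + X * derivative K F := by
    simp [Derivation.leibniz, add_comm]
  rcases k with _ | k
  · simp [hd, hF]
  · have h1 : derivative K (F⁻¹ ^ (k + 1)) =
        -(((k + 1 : ℕ) : K⟦X⟧) * (F⁻¹ ^ (k + 2) * derivative K F)) := by
      rw [Derivation.leibniz_pow, derivative_inv']
      simp only [smul_eq_mul, nsmul_eq_mul, Nat.add_sub_cancel]
      ring
    have h2 : F⁻¹ ^ (k + 2) * derivative K (X * F) =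
        F⁻¹ ^ (k + 1) + X * (F⁻¹ ^ (k + 2) * derivative K F) := by
      rw [hd]
      linear_combination F⁻¹ ^ (k + 1) * hinv
    have h3 := congrArg (coeff k) h1
    rw [coeff_derivative, map_neg, ← map_natCast (C (R := K)), coeff_C_mul] at h3
    rw [h2, map_add, coeff_succ_X_mul, if_neg (Nat.succ_ne_zero k)]
    have hk : ((k + 1 : ℕ) : K) ≠ 0 := Nat.cast_ne_zero.2 (Nat.succ_ne_zero k)
    apply mul_left_cancel₀ hk
    push_cast at h3 ⊢
    linear_combination h3

/-- Taking the coefficient of `Xⁿ` after multiplication by `F⁻⁽ⁿ⁺¹⁾` is the residue against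
`f^(-n-1)`. These functionals are dual to the series `f^j f'`. -/
theorem coeff_X_mul_pow_mul_derivative [CharZero K] {F : K⟦X⟧} (hF : constantCoeff F = 1)
    (j n : ℕ) : coeff n ((X * F) ^ j * derivative K (X * F) * F⁻¹ ^ (n + 1)) =
      if j = n then 1 else 0 := by
  have hF0 : constantCoeff F ≠ 0 := by simp [hF]
  have hinv : F⁻¹ * F = 1 := PowerSeries.inv_mul_cancel F hF0
  rw [mul_pow, mul_assoc, mul_assoc, coeff_X_pow_mul']
  split_ifs with h1 h2 h2
  · subst h2
    have := coeff_inv_pow_mul_derivative_X_mul hF 0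
    rw [if_pos rfl] at this
    rw [← this, Nat.sub_self, zero_add, pow_one]
    congr 1
    have := congrArg (· ^ j) hinv
    simp only [mul_pow, one_pow] at this
    linear_combination derivative K (X * F) * F⁻¹ * this
  · obtain ⟨k, rfl⟩ := Nat.exists_eq_add_of_le h1
    have := coeff_inv_pow_mul_derivative_X_mul hF k
    rw [if_neg (by omega)] at this
    rw [← this, Nat.add_sub_cancel_left]
    congr 1
    have := congrArg (· ^ j) hinv
    simp only [mul_pow, one_pow] at this
    linear_combination derivative K (X * F) * F⁻¹ ^ (k + 1) * this
  · omega
  · rfl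

/-- Since `f = X F` has order one and leading coefficient one, its powers remove the lowest
remaining coefficient one degree at a time. -/
theorem exists_X_pow_dvd_sub_sum {F : K⟦X⟧} (hF : constantCoeff F = 1) {H : K⟦X⟧}
    (hH : constantCoeff H = 0) (N : ℕ) :
    ∃ h : ℕ → K, X ^ (N + 1) ∣ H - ∑ m ∈ Finset.range N, C (h m) * (X * F) ^ (m + 1) := by
  induction N with
  | zero => exact ⟨0, by simpa [X_dvd_iff] using hH⟩
  | succ N ih =>
    obtain ⟨h, R, hR⟩ := ih
    refine ⟨Function.update h N (constantCoeff R), ?_⟩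
    have hsum : ∑ m ∈ Finset.range N,
        C (Function.update h N (constantCoeff R) m) * (X * F) ^ (m + 1) =
        ∑ m ∈ Finset.range N, C (h m) * (X * F) ^ (m + 1) :=
      Finset.sum_congr rfl fun m hm => by
        rw [Function.update_of_ne (Finset.mem_range.1 hm).ne]
    rw [Finset.sum_range_succ, hsum, Function.update_self, ← sub_sub, hR, mul_pow, pow_succ,
      show (X : K⟦X⟧) ^ (N + 1) * R - C (constantCoeff R) * (X ^ (N + 1) * F ^ (N + 1)) =
        X ^ (N + 1) * (R - C (constantCoeff R) * F ^ (N + 1)) by ring]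
    exact mul_dvd_mul_left _ (by simp [X_dvd_iff, hF])

theorem X_pow_dvd_derivative {H : K⟦X⟧} {N : ℕ} (h : X ^ (N + 1) ∣ H) :
    X ^ N ∣ derivative K H := by
  rw [X_pow_dvd_iff] at h ⊢
  intro m hm
  rw [coeff_derivative, h _ (by omega), zero_mul]

/-- Lagrange–Bürmann: differentiating the expansion of `H` in powers of `f` gives a combination of
the `f^m f'`, from which the residue pairing isolates one coefficient. -/
theorem coeff_derivative_mul_inv_pow [CharZero K] {F : K⟦X⟧} (hF : constantCoeff F = 1)
    {H : K⟦X⟧} {N : ℕ} {h : ℕ → K}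
    (hH : X ^ (N + 1) ∣ H - ∑ m ∈ Finset.range N, C (h m) * (X * F) ^ (m + 1)) {n : ℕ}
    (hn : n < N) : coeff n (derivative K H * F⁻¹ ^ (n + 1)) = (n + 1) * h n := by
  have h1 := X_pow_dvd_iff.1 ((X_pow_dvd_derivative hH).mul_right (F⁻¹ ^ (n + 1))) n hn
  rw [map_sub, sub_mul, map_sub, sub_eq_zero] at h1
  rw [h1, map_sum, Finset.sum_mul, map_sum, Finset.sum_eq_single n]
  · rw [Derivation.leibniz, Derivation.leibniz_pow]
    simp only [derivative_C, smul_eq_mul, mul_zero, add_zero, nsmul_eq_mul, Nat.add_sub_cancel]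
    have := coeff_X_mul_pow_mul_derivative hF n n
    rw [if_pos rfl] at this
    rw [mul_assoc, coeff_C_mul, ← map_natCast (C (R := K)), mul_assoc, coeff_C_mul, this]
    push_cast
    ring
  · intro m _ hm
    rw [Derivation.leibniz, Derivation.leibniz_pow]
    simp only [derivative_C, smul_eq_mul, mul_zero, add_zero, nsmul_eq_mul, Nat.add_sub_cancel]
    have := coeff_X_mul_pow_mul_derivative hF m n
    rw [if_neg hm] at this
    rw [mul_assoc, coeff_C_mul, ← map_natCast (C (R := K)), mul_assoc, coeff_C_mul, this]
    simp
  · exact fun h => absurd (Finset.mem_range.2 hn) h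

/-- The matrix `(α_{i,j})` expressed through a power series `F`. -/
noncomputable def alphaMatrix (F : K⟦X⟧) (d e : ℕ) : Matrix (Fin e) (Fin e) K :=
  Matrix.of fun k j => coeff (d + 1 + j) (X ^ ((k : ℕ) + 2) * F⁻¹ ^ (d + 1 + (j : ℕ) + 1))

/-- The residue pairings with `n > d` annihilate every `f^(m+1) f'` with `m < d`, so those with `d <
n ≤ d + e` leave a square linear system for `x` alone, with matrix `alphaMatrix`. Once `x = 0`, the
pairings with `1 ≤ n ≤ d` read off the entries of `b`. -/
theorem eq_zero_of_X_pow_dvd_sum [CharZero K] {F : K⟦X⟧} (hF : constantCoeff F = 1) {d e : ℕ}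
    (hdet : (alphaMatrix F d e).det ≠ 0) {x : Fin e → K} {b : Fin d → K}
    (h : X ^ (d + e + 1) ∣ ∑ k, C (x k) * X ^ ((k : ℕ) + 2) +
      (∑ m, C (b m) * (X * F) ^ ((m : ℕ) + 1)) * derivative K (X * F)) : x = 0 ∧ b = 0 := by
  have hb : ∀ n, coeff n ((∑ m, C (b m) * (X * F) ^ ((m : ℕ) + 1)) * derivative K (X * F) *
      F⁻¹ ^ (n + 1)) = ∑ m, b m * if (m : ℕ) + 1 = n then 1 else 0 := fun n => by
    rw [Finset.sum_mul, Finset.sum_mul, map_sum]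
    refine Finset.sum_congr rfl fun m _ => ?_
    rw [mul_assoc, mul_assoc, coeff_C_mul, ← mul_assoc, coeff_X_mul_pow_mul_derivative hF]
  have hx : x = 0 := by
    refine Matrix.eq_zero_of_vecMul_eq_zero hdet (funext fun j => ?_)
    have := X_pow_dvd_iff.1 (h.mul_right (F⁻¹ ^ (d + 1 + (j : ℕ) + 1))) (d + 1 + j) (by omega)
    rw [add_mul, map_add, hb, Finset.sum_eq_zero (s := Finset.univ (α := Fin d)) fun m _ => by
      rw [if_neg (by omega), mul_zero], add_zero, Finset.sum_mul, map_sum] at this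
    simp only [mul_assoc, coeff_C_mul] at this
    exact this
  refine ⟨hx, funext fun m => ?_⟩
  have := X_pow_dvd_iff.1 (h.mul_right (F⁻¹ ^ ((m : ℕ) + 1 + 1))) (m + 1) (by omega)
  rw [add_mul, map_add, hb] at this
  simpa [hx, Fin.val_inj] using this

/-! ### The values of `g_{n,e}` and `a_{d,e}` as power series coefficients -/

/-- The power series `1 + x₁ X + ⋯ + xₑ X ^ e`. -/
noncomputable def unitSeries {e : ℕ} (x : Fin e → K) : K⟦X⟧ :=
  1 + ∑ k, C (x k) * X ^ ((k : ℕ) + 1)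

theorem constantCoeff_unitSeries {e : ℕ} (x : Fin e → K) : constantCoeff (unitSeries x) = 1 := by
  simp [unitSeries]

theorem _root_.Nat.multinomial_univ_fin_cons {e : ℕ} (m : ℕ) (a : Fin e → ℕ) :
    Nat.multinomial Finset.univ (Fin.cons m a : Fin (e + 1) → ℕ) =
      (m + ∑ k, a k).choose m * Nat.multinomial Finset.univ a := by
  have h1 := Nat.multinomial_spec (Finset.univ) (Fin.cons m a : Fin (e + 1) → ℕ)
  have h2 := Nat.multinomial_spec Finset.univ a
  rw [Fin.prod_univ_succ, Fin.sum_univ_succ] at h1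
  simp only [Fin.cons_zero, Fin.cons_succ] at h1
  have h3 := Nat.add_choose_mul_factorial_mul_factorial m (∑ k, a k)
  have hpos : 0 < m.factorial * ∏ k, (a k).factorial :=
    Nat.mul_pos m.factorial_pos (Finset.prod_pos fun k _ => (a k).factorial_pos)
  apply Nat.eq_of_mul_eq_mul_left hpos
  rw [h1, ← h3, ← h2, Nat.choose_symm_add]
  ring

theorem coeff_sum_C_mul_X_pow_pow {e : ℕ} (y : Fin e → K) (n s : ℕ) :
    coeff n ((∑ k, C (y k) * X ^ ((k : ℕ) + 1)) ^ s) =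
      ∑ a ∈ weightedExponents e n with ∑ k, a k = s,
        (Nat.multinomial Finset.univ a : K) * ∏ k, y k ^ a k := by
  have hset : (weightedExponents e n).filter (fun a => ∑ k, a k = s) =
      (Finset.univ.piAntidiag s).filter fun a => n = ∑ k : Fin e, ((k : ℕ) + 1) * a k := by
    ext a
    simp [mem_weightedExponents, Finset.mem_piAntidiag, eq_comm, and_comm]
  rw [hset, Finset.sum_filter, Finset.sum_pow_eq_sum_piAntidiag, map_sum]
  refine Finset.sum_congr rfl fun a _ => ?_
  simp only [mul_pow, ← map_pow, ← pow_mul, Finset.prod_mul_distrib]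
  rw [Finset.prod_pow_eq_pow_sum, ← map_prod, ← map_natCast (C (R := K)), coeff_C_mul, coeff_C_mul,
    coeff_X_pow]
  split_ifs <;> simp

/-- Substitution of `Z` in the negative binomial series; the sum stops at `n` because `X^s` divides
`Z^s`. -/
theorem coeff_inv_one_sub_pow {Z : K⟦X⟧} (hZ : constantCoeff Z = 0) (n m : ℕ) :
    coeff n ((1 - Z)⁻¹ ^ (m + 1)) =
      ∑ s ∈ Finset.range (n + 1), ((m + s).choose m : K) * coeff n (Z ^ s) := by
  have hs : HasSubst Z := HasSubst.of_constantCoeff_zero' hZ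
  have h1 := congrArg (substAlgHom hs) (mk_add_choose_mul_one_sub_pow_eq_one K m)
  rw [map_mul, map_pow, map_sub, map_one, substAlgHom_X] at h1
  have h2 : (1 - Z)⁻¹ * (1 - Z) = 1 := PowerSeries.inv_mul_cancel _ (by simp [hZ])
  have h3 : (1 - Z)⁻¹ ^ (m + 1) = substAlgHom hs (mk fun n => ((m + n).choose m : K)) := by
    have h4 := congrArg (· ^ (m + 1)) h2
    simp only [mul_pow, one_pow] at h4
    linear_combination substAlgHom hs (mk fun n => ((m + n).choose m : K)) * h4 -
      (1 - Z)⁻¹ ^ (m + 1) * h1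
  rw [h3, coe_substAlgHom, coeff_subst' hs, finsum_eq_sum_of_support_subset]
  · exact Finset.sum_congr rfl fun s _ => by rw [coeff_mk, smul_eq_mul]
  · intro s hs'
    by_contra hlt
    simp only [Finset.coe_range, Set.mem_Iio, not_lt] at hlt
    refine hs' ?_
    have : X ^ s ∣ Z ^ s := pow_dvd_pow_of_dvd (X_dvd_iff.2 hZ) s
    change _ • coeff n (Z ^ s) = 0
    rw [X_pow_dvd_iff.1 this n (by omega), smul_zero]

/-- Apply the negative binomial series to `Z = -∑ xₖ Xᵏ` and expand the powers of `Z`. The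
multinomial coefficient splits as `(m + |a|).choose m` times that of `a` alone, so grouping
exponents by `|a|` matches the two sums. -/
theorem aeval_multinomialSum {e : ℕ} (x : Fin e → K) (n m : ℕ) :
    MvPolynomial.aeval x (multinomialSum K e n m) = coeff n ((unitSeries x)⁻¹ ^ (m + 1)) := by
  have hU : unitSeries x = 1 - ∑ k, C (-x k) * X ^ ((k : ℕ) + 1) := by
    simp [unitSeries, Finset.sum_neg_distrib]
  rw [hU, coeff_inv_one_sub_pow (by simp)]
  simp only [coeff_sum_C_mul_X_pow_pow, Finset.mul_sum]
  have hmap : ∀ a ∈ weightedExponents e n, ∑ k, a k ∈ Finset.range (n + 1) := fun a ha => by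
    rw [mem_weightedExponents] at ha
    rw [Finset.mem_range, Nat.lt_succ_iff, ← ha]
    exact Finset.sum_le_sum fun k _ => Nat.le_mul_of_pos_left _ (Nat.succ_pos _)
  rw [multinomialSum, map_sum, ← Finset.sum_fiberwise_of_maps_to hmap]
  refine Finset.sum_congr rfl fun s _ => Finset.sum_congr rfl fun a ha => ?_
  obtain ⟨-, rfl⟩ := Finset.mem_filter.1 ha
  rw [Nat.multinomial_univ_fin_cons]
  simp only [map_mul, map_prod, map_pow, MvPolynomial.aeval_X, MvPolynomial.aeval_C, neg_pow (x _),
    Finset.prod_mul_distrib, Finset.prod_pow_eq_pow_sum, Nat.cast_mul, Algebra.algebraMap_self,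
    RingHom.id_apply]
  ring

theorem aeval_gPoly {e : ℕ} (x : Fin e → K) (n : ℕ) :
    MvPolynomial.aeval x (gPoly K n e) =
      1 / ((n : K) + 1) * coeff n ((unitSeries x)⁻¹ ^ (n + 1)) := by
  rw [gPoly, map_mul, aeval_multinomialSum]
  simp

/-- The column index `d - 1 + j` corresponds to the residue index `n = d + 1 + j`, and `hd` makes
the subtraction genuine. The zero entries of the determinant are those where `X^(k+2)` has order
larger than `n`. -/
theorem aeval_aPoly {e : ℕ} (x : Fin e → K) {d : ℕ} (hd : 1 ≤ d) :
    MvPolynomial.aeval x (aPoly K d e) = (alphaMatrix (unitSeries x) d e).det := by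
  rw [aPoly, AlgHom.map_det]
  congr 1
  ext i j
  simp only [AlgHom.mapMatrix_apply, Matrix.map_apply, Matrix.of_apply, alphaPoly, alphaMatrix]
  rw [coeff_X_pow_mul', apply_ite (MvPolynomial.aeval x), aeval_multinomialSum, map_zero]
  have h1 : d - 1 + (j : ℕ) + 2 + 1 = d + 1 + j + 1 := by omega
  have h2 : d + 1 + (j : ℕ) - (i + 2) = d - 1 + j - i := by omega
  have h3 : ((i : ℕ) + 2 ≤ d + 1 + j) ↔ (i : ℕ) ≤ d - 1 + j := by omega
  rw [h1, h2]
  simp only [h3]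

/-- Truncated inversion: if the coefficients `g_d, …, g_{d+e-2}` of the compositional inverse of
`X * F` vanish, then its truncation at degree `d` inverts `X * F` up to order `d + e`. -/
theorem X_pow_dvd_sum_sub [CharZero K] {F : K⟦X⟧} (hF : constantCoeff F = 1) {d e : ℕ} (he : 1 ≤ e)
    {g : ℕ → K} (hg : ∀ n : ℕ, ((n : K) + 1) * g n = coeff n (F⁻¹ ^ (n + 1)))
    (hg0 : ∀ i, i + 2 ≤ e → g (d + i) = 0) :
    X ^ (d + e + 1) ∣ ∑ m : Fin d, C (g m) * (X * F) ^ ((m : ℕ) + 1) -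
      (X - C (g (d + e - 1)) * X ^ (d + e)) := by
  obtain ⟨h, hh⟩ := exists_X_pow_dvd_sub_sum hF (H := X) (by simp) (d + e)
  -- Lagrange inversion: `h` expands the series `X` itself in powers of `X F`, so it lists the
  -- coefficients of the compositional inverse.
  have hgh : ∀ n < d + e, h n = g n := fun n hn => by
    have := coeff_derivative_mul_inv_pow hF hh hn
    rw [derivative_X, one_mul, ← hg] at this
    exact (mul_left_cancel₀ (by exact_mod_cast Nat.succ_ne_zero n) this).symm
  have hsum : ∑ m ∈ Finset.range (d + e), C (h m) * (X * F) ^ (m + 1) =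
      ∑ m : Fin d, C (g m) * (X * F) ^ ((m : ℕ) + 1) +
        C (g (d + e - 1)) * (X * F) ^ (d + e) := by
    obtain ⟨e, rfl⟩ := Nat.exists_eq_add_of_le' he
    rw [← add_assoc, Finset.sum_range_succ, Finset.sum_range_add,
      Finset.sum_eq_zero (s := Finset.range e) fun i hi => ?_, add_zero,
      Fin.sum_univ_eq_sum_range (fun m => C (g m) * (X * F) ^ (m + 1)) d, hgh (d + e) (by omega)]
    · rw [Nat.add_sub_cancel]
      congr 1
      exact Finset.sum_congr rfl fun m hm => by
        rw [hgh m (by have := Finset.mem_range.1 hm; omega)]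
    · have := Finset.mem_range.1 hi
      rw [hgh _ (by omega), hg0 i (by omega), map_zero, zero_mul]
  rw [hsum] at hh
  -- In the top term `(X F)^(d+e)` may be replaced by `X^(d+e)`, since `F` has constant term one.
  have hX : X ^ (d + e + 1) ∣ C (g (d + e - 1)) * (X ^ (d + e) - (X * F) ^ (d + e)) := by
    rw [mul_pow, pow_succ, show (X : K⟦X⟧) ^ (d + e) - X ^ (d + e) * F ^ (d + e) =
      X ^ (d + e) * (1 - F ^ (d + e)) by ring]
    exact (mul_dvd_mul_left _ (by simp [X_dvd_iff, hF])).mul_left _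
  have := dvd_sub hX hh
  convert this using 1
  ring

end PowerSeries

/-! ### Differentiation of coefficients and the inverse function theorem -/

section CoeffDeriv

variable {V : Type*} [NormedAddCommGroup V] [NormedSpace ℂ V]

/-- Every coefficient of the family `q` of power series is strictly differentiable at `a`, and the
derivatives are the coefficients of `q'`. -/
def HasCoeffDerivAt (q q' : V → PowerSeries ℂ) (a : V) : Prop :=
  ∀ n, ∃ L : V →L[ℂ] ℂ, (∀ v, L v = PowerSeries.coeff n (q' v)) ∧
    HasStrictFDerivAt (fun p => PowerSeries.coeff n (q p)) L a

namespace HasCoeffDerivAt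

variable {q q' r r' : V → PowerSeries ℂ} {a : V}

theorem const (F : PowerSeries ℂ) : HasCoeffDerivAt (fun _ => F) (fun _ => 0) a :=
  fun n => ⟨0, fun v => by simp, hasStrictFDerivAt_const _ _⟩

theorem C (φ : V →L[ℂ] ℂ) :
    HasCoeffDerivAt (fun p => PowerSeries.C (φ p)) (fun v => PowerSeries.C (φ v)) a := by
  intro n
  rcases n with _ | n
  · exact ⟨φ, fun v => by simp, by simpa using φ.hasStrictFDerivAt⟩
  · exact ⟨0, fun v => by simp, by
      simpa [PowerSeries.coeff_C] using hasStrictFDerivAt_const (𝕜 := ℂ) (0 : ℂ) a⟩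

theorem add (hq : HasCoeffDerivAt q q' a) (hr : HasCoeffDerivAt r r' a) :
    HasCoeffDerivAt (fun p => q p + r p) (fun v => q' v + r' v) a := by
  intro n
  obtain ⟨L, hL, h⟩ := hq n
  obtain ⟨L', hL', h'⟩ := hr n
  exact ⟨L + L', fun v => by simp [hL, hL'], by simpa using h.fun_add h'⟩

theorem sum {κ : Type*} (s : Finset κ) {q q' : κ → V → PowerSeries ℂ}
    (h : ∀ k ∈ s, HasCoeffDerivAt (q k) (q' k) a) :
    HasCoeffDerivAt (fun p => ∑ k ∈ s, q k p) (fun v => ∑ k ∈ s, q' k v) a := by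
  classical
  induction s using Finset.induction_on with
  | empty => simpa using const (a := a) 0
  | insert b s hb ih =>
    simp only [Finset.sum_insert hb]
    exact (h b (by simp)).add (ih fun k hk => h k (by simp [hk]))

theorem mul (hq : HasCoeffDerivAt q q' a) (hr : HasCoeffDerivAt r r' a) :
    HasCoeffDerivAt (fun p => q p * r p) (fun v => q' v * r a + q a * r' v) a := by
  intro n
  choose L hL h using hq
  choose L' hL' h' using hr
  refine ⟨∑ x ∈ Finset.HasAntidiagonal.antidiagonal n, (PowerSeries.coeff x.1 (q a) • L' x.2 +
    PowerSeries.coeff x.2 (r a) • L x.1), fun v => ?_, ?_⟩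
  · simp only [map_add, PowerSeries.coeff_mul, sum_apply,
      add_apply, smul_apply, hL, hL', smul_eq_mul,
      Finset.sum_add_distrib]
    rw [add_comm]
    congr 1
    exact Finset.sum_congr rfl fun x _ => mul_comm _ _
  · simp only [PowerSeries.coeff_mul]
    exact HasStrictFDerivAt.fun_sum fun x _ => (h x.1).fun_mul (h' x.2)

theorem pow (hq : HasCoeffDerivAt q q' a) (n : ℕ) :
    HasCoeffDerivAt (fun p => q p ^ (n + 1))
      (fun v => ((n + 1 : ℕ) : PowerSeries ℂ) * q a ^ n * q' v) a := by
  induction n with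
  | zero => simpa using hq
  | succ n ih =>
    convert ih.mul hq using 2 with p v
    · exact pow_succ _ _
    · push_cast
      ring

end HasCoeffDerivAt

end CoeffDeriv

namespace PowerSeries

/-- The composition `b₁ f + ⋯ + b_d f ^ d`, where `f = X + x₁ X ^ 2 + ⋯ + xₑ X ^ (e + 1)`. -/
noncomputable def compSeries {d e : ℕ} (p : (Fin e → ℂ) × (Fin d → ℂ)) : ℂ⟦X⟧ :=
  ∑ m, C (p.2 m) * (X * unitSeries p.1) ^ ((m : ℕ) + 1)

variable {d e : ℕ}

/-- The derivative of `G ∘ f` in direction `(ẋ, ḃ)` is `Ġ(f) + G'(f) δ`, with `δ = ∑ ẋₖ X^(k+2)` the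
variation of `f`, where `k` counts from `0`. -/
theorem hasCoeffDerivAt_compSeries (a : (Fin e → ℂ) × (Fin d → ℂ)) :
    HasCoeffDerivAt compSeries (fun v => ∑ m : Fin d,
      (C (v.2 m) * (X * unitSeries a.1) ^ ((m : ℕ) + 1) +
        C (a.2 m) * ((((m : ℕ) + 1 : ℕ) : ℂ⟦X⟧) * (X * unitSeries a.1) ^ (m : ℕ) *
          ∑ k, C (v.1 k) * X ^ ((k : ℕ) + 2)))) a := by
  have hf : HasCoeffDerivAt (fun p : (Fin e → ℂ) × (Fin d → ℂ) => X * unitSeries p.1)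
      (fun v => ∑ k, C (v.1 k) * X ^ ((k : ℕ) + 2)) a := by
    have h1 := (HasCoeffDerivAt.const (a := a) X).add
      (HasCoeffDerivAt.sum Finset.univ fun (k : Fin e) _ =>
        (HasCoeffDerivAt.C (a := a) ((ContinuousLinearMap.proj (R := ℂ) k).comp
          (ContinuousLinearMap.fst ℂ (Fin e → ℂ) (Fin d → ℂ)))).mul
          (HasCoeffDerivAt.const (X ^ ((k : ℕ) + 2))))
    convert h1 using 2 with p v
    · rw [unitSeries, mul_add, mul_one, Finset.mul_sum]
      congr 1
      refine Finset.sum_congr rfl fun k _ => ?_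
      simp only [ContinuousLinearMap.comp_apply, ContinuousLinearMap.proj_apply,
        ContinuousLinearMap.coe_fst']
      ring
    · simp
  have h2 := HasCoeffDerivAt.sum Finset.univ fun (m : Fin d) _ =>
    (HasCoeffDerivAt.C (a := a) ((ContinuousLinearMap.proj (R := ℂ) m).comp
      (ContinuousLinearMap.snd ℂ (Fin e → ℂ) (Fin d → ℂ)))).mul (hf.pow m)
  exact h2

/-- The coefficients of degrees `1, …, d + e` of `compSeries`. -/
noncomputable def compCoeffs (p : (Fin e → ℂ) × (Fin d → ℂ)) (j : Fin (d + e)) : ℂ :=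
  coeff ((j : ℕ) + 1) (compSeries p)

theorem X_dvd_sum_C_mul_X_mul_pow {R : Type*} [CommRing R] (F : R⟦X⟧) (b : Fin d → R) :
    X ∣ ∑ m, C (b m) * (X * F) ^ ((m : ℕ) + 1) :=
  Finset.dvd_sum fun m _ => ((dvd_mul_right X F).trans (dvd_pow_self _ (by omega))).mul_left _

/-- The inverse function theorem for `compCoeffs`. -/
theorem exists_tendsto_compCoeffs_eq (a : (Fin e → ℂ) × (Fin d → ℂ))
    (hdet : (alphaMatrix (unitSeries a.1) d e).det ≠ 0)
    (ha : X ^ (d + e) ∣ compSeries a - X) :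
    ∃ s : (Fin (d + e) → ℂ) → (Fin e → ℂ) × (Fin d → ℂ),
      Tendsto s (𝓝 (compCoeffs a)) (𝓝 a) ∧
        ∀ᶠ c in 𝓝 (compCoeffs a), compCoeffs (s c) = c := by
  choose L hL hderiv using hasCoeffDerivAt_compSeries a
  set f : ℂ⟦X⟧ := X * unitSeries a.1 with hf
  set L' : (Fin e → ℂ) × (Fin d → ℂ) →L[ℂ] (Fin (d + e) → ℂ) :=
    ContinuousLinearMap.pi fun j => L (j + 1) with hL'
  have hstrict : HasStrictFDerivAt (compCoeffs (d := d) (e := e)) L' a :=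
    hasStrictFDerivAt_pi.2 fun j => hderiv (j + 1)
  -- A kernel vector satisfies `Ġ(f) + G'(f) δ ≡ 0` modulo `X^(d+e+1)`. Multiplication by `f'`
  -- replaces `G'(f)` by `(G ∘ f)'`, which is congruent to `1`, and the residue criterion then
  -- applies.
  have hinj : Function.Injective L' := by
    rw [injective_iff_map_eq_zero]
    intro v hv
    set δ : ℂ⟦X⟧ := ∑ k, C (v.1 k) * X ^ ((k : ℕ) + 2) with hδ
    have hδ2 : X ^ 2 ∣ δ := Finset.dvd_sum fun k _ => by
      rw [pow_add]
      exact ((dvd_mul_left _ _).mul_left _)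
    have h1 : X ^ (d + e + 1) ∣ ∑ m : Fin d, (C (v.2 m) * f ^ ((m : ℕ) + 1) +
        C (a.2 m) * ((((m : ℕ) + 1 : ℕ) : ℂ⟦X⟧) * f ^ (m : ℕ) * δ)) := by
      rw [X_pow_dvd_iff]
      intro n hn
      rcases n with _ | n
      · rw [coeff_zero_eq_constantCoeff_apply, ← X_dvd_iff, Finset.sum_add_distrib]
        refine dvd_add (X_dvd_sum_C_mul_X_mul_pow _ _) (Finset.dvd_sum fun m _ => ?_)
        exact ((((dvd_pow_self X two_ne_zero).trans hδ2).mul_left _).mul_left _)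
      · rw [← hL]
        exact congrFun hv ⟨n, by omega⟩
    have h2 : derivative ℂ (compSeries a) =
        ∑ m : Fin d, C (a.2 m) * ((((m : ℕ) + 1 : ℕ) : ℂ⟦X⟧) * f ^ (m : ℕ)) *
          derivative ℂ f := by
      rw [compSeries, map_sum]
      refine Finset.sum_congr rfl fun m _ => ?_
      rw [Derivation.leibniz, Derivation.leibniz_pow]
      simp only [derivative_C, smul_eq_mul, mul_zero, add_zero, nsmul_eq_mul, Nat.add_sub_cancel]
      ring
    -- Differentiating `ha` loses one order, leaving `(G ∘ f)' ≡ 1` modulo `X^(d+e-1)`; the factor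
    -- `X²` in `δ` restores the required precision.
    have h3 : X ^ (d + e + 1) ∣ (derivative ℂ (compSeries a) - 1) * δ := by
      rcases Nat.eq_zero_or_pos (d + e) with h0 | hpos
      · rw [h0, zero_add, pow_one]
        exact ((dvd_pow_self X two_ne_zero).trans hδ2).mul_left _
      · obtain ⟨n, hn⟩ := Nat.exists_eq_succ_of_ne_zero hpos.ne'
        rw [hn] at ha ⊢
        have h4 := X_pow_dvd_derivative ha
        rw [map_sub, derivative_X] at h4
        rw [show n.succ + 1 = n + 2 by omega, pow_add]
        exact mul_dvd_mul h4 hδ2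
    have h5 : X ^ (d + e + 1) ∣ δ + (∑ m, C (v.2 m) * f ^ ((m : ℕ) + 1)) * derivative ℂ f := by
      convert dvd_sub (h1.mul_right (derivative ℂ f)) h3 using 1
      rw [h2, Finset.sum_add_distrib, add_mul, sub_mul, Finset.sum_mul, Finset.sum_mul,
        Finset.sum_mul, one_mul]
      have : ∑ m : Fin d, C (a.2 m) * ((((m : ℕ) + 1 : ℕ) : ℂ⟦X⟧) * f ^ (m : ℕ) * δ) *
          derivative ℂ f = ∑ m : Fin d, C (a.2 m) * ((((m : ℕ) + 1 : ℕ) : ℂ⟦X⟧) * f ^ (m : ℕ)) *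
          derivative ℂ f * δ := Finset.sum_congr rfl fun m _ => by ring
      rw [this]
      ring
    obtain ⟨hx, hb⟩ := eq_zero_of_X_pow_dvd_sum (constantCoeff_unitSeries a.1) hdet h5
    exact Prod.ext hx hb
  have hrank : Module.finrank ℂ ((Fin e → ℂ) × (Fin d → ℂ)) =
      Module.finrank ℂ (Fin (d + e) → ℂ) := by
    simp [add_comm]
  have hsurj : Function.Surjective L' :=
    (LinearMap.injective_iff_surjective_of_finrank_eq_finrank
      (f := (L' : (Fin e → ℂ) × (Fin d → ℂ) →ₗ[ℂ] (Fin (d + e) → ℂ))) hrank).1 hinj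
  set Le := (LinearEquiv.ofBijective
    (L' : (Fin e → ℂ) × (Fin d → ℂ) →ₗ[ℂ] (Fin (d + e) → ℂ))
      ⟨hinj, hsurj⟩).toContinuousLinearEquiv
  have hstrict' : HasStrictFDerivAt (compCoeffs (d := d) (e := e))
      (Le : (Fin e → ℂ) × (Fin d → ℂ) →L[ℂ] (Fin (d + e) → ℂ)) a :=
    hstrict
  exact ⟨hstrict'.localInverse _ _ _, hstrict'.localInverse_tendsto,
    hstrict'.eventually_right_inverse⟩

end PowerSeries

/-! ### The degenerating family of automorphisms -/

/-- The polynomial `X + x₁ X ^ 2 + ⋯ + xₑ X ^ (e + 1)`. -/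
noncomputable def innerPoly {e : ℕ} (x : Fin e → ℂ) : Polynomial ℂ :=
  Polynomial.X + ∑ k, Polynomial.C (x k) * Polynomial.X ^ ((k : ℕ) + 2)

/-- The polynomial `b₁ X + ⋯ + b_d X ^ d`. -/
noncomputable def outerPoly {d : ℕ} (b : Fin d → ℂ) : Polynomial ℂ :=
  ∑ m, Polynomial.C (b m) * Polynomial.X ^ ((m : ℕ) + 1)

theorem natDegree_innerPoly_le {e : ℕ} (x : Fin e → ℂ) : (innerPoly x).natDegree ≤ e + 1 := by
  refine (Polynomial.natDegree_add_le _ _).trans (max_le (by simp) ?_)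
  exact Polynomial.natDegree_sum_le_of_forall_le _ _ fun k _ =>
    (Polynomial.natDegree_C_mul_X_pow_le _ _).trans (by omega)

theorem natDegree_innerPoly {e : ℕ} (x : Fin (e + 1) → ℂ) (hx : x (Fin.last e) ≠ 0) :
    (innerPoly x).natDegree = e + 2 := by
  refine Polynomial.natDegree_eq_of_le_of_coeff_ne_zero (natDegree_innerPoly_le x) ?_
  simp only [innerPoly, Polynomial.coeff_add, Polynomial.finsetSum_coeff,
    Polynomial.coeff_C_mul_X_pow, Polynomial.coeff_X]
  rw [if_neg (by omega), zero_add, Finset.sum_eq_single (Fin.last e)]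
  · simpa using hx
  · intro k _ hk
    have := Fin.val_lt_last hk
    exact if_neg (by omega)
  · simp

theorem natDegree_outerPoly_le {d : ℕ} (b : Fin d → ℂ) : (outerPoly b).natDegree ≤ d :=
  Polynomial.natDegree_sum_le_of_forall_le _ _ fun k _ =>
    (Polynomial.natDegree_C_mul_X_pow_le _ _).trans (by omega)

theorem natDegree_outerPoly {d : ℕ} (b : Fin (d + 1) → ℂ) (hb : b (Fin.last d) ≠ 0) :
    (outerPoly b).natDegree = d + 1 := by
  refine Polynomial.natDegree_eq_of_le_of_coeff_ne_zero (natDegree_outerPoly_le b) ?_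
  simp only [outerPoly, Polynomial.finsetSum_coeff, Polynomial.coeff_C_mul_X_pow]
  rw [Finset.sum_eq_single (Fin.last d)]
  · simpa using hb
  · intro k _ hk
    have := Fin.val_lt_last hk
    exact if_neg (by omega)
  · simp

theorem coe_outerPoly_comp_innerPoly {d e : ℕ} (p : (Fin e → ℂ) × (Fin d → ℂ)) :
    (((outerPoly p.2).comp (innerPoly p.1) : Polynomial ℂ) : PowerSeries ℂ) =
      PowerSeries.compSeries p := by
  have h : ((innerPoly p.1 : Polynomial ℂ) : PowerSeries ℂ) =
      PowerSeries.X * PowerSeries.unitSeries p.1 := by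
    rw [← Polynomial.coeToPowerSeries.ringHom_apply, innerPoly, map_add, map_sum,
      PowerSeries.unitSeries, mul_add, mul_one, Finset.mul_sum]
    congr 1
    · simp
    · refine Finset.sum_congr rfl fun k _ => ?_
      simp
      ring
  rw [outerPoly, PowerSeries.compSeries, Polynomial.sum_comp,
    ← Polynomial.coeToPowerSeries.ringHom_apply, map_sum]
  refine Finset.sum_congr rfl fun m _ => ?_
  simp [h]

section Family

variable {d e : ℕ}

/-- The polynomial `f(tY)`, where `f = innerPoly x`. -/
noncomputable def scaledInner (t : ℂ) (x : Fin e → ℂ) : MvPolynomial (Fin 2) ℂ :=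
  Polynomial.aeval (MvPolynomial.C t * MvPolynomial.X 1) (innerPoly x)

/-- The polynomial `tᴺ X + f(tY)`, where `f = innerPoly x`. -/
noncomputable def shiftedInner (N : ℕ) (t : ℂ) (x : Fin e → ℂ) : MvPolynomial (Fin 2) ℂ :=
  MvPolynomial.C (t ^ N) * MvPolynomial.X 0 + scaledInner t x

/-- The components of the automorphism `(t⁻ᴺ X, t⁻¹ Y) ∘ (X - G(Y), Y) ∘ (Y, X) ∘ (X + f(Y), Y) ∘
(tᴺ X, t Y)`, where `f = innerPoly p.1`, `G = outerPoly p.2` and `N = d + e`. -/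
noncomputable def familyCoord (t : ℂ) (p : (Fin e → ℂ) × (Fin d → ℂ)) :
    Fin 2 → MvPolynomial (Fin 2) ℂ :=
  ![MvPolynomial.C (t ^ (d + e))⁻¹ * (MvPolynomial.C t * MvPolynomial.X 1 -
      Polynomial.aeval (shiftedInner (d + e) t p.1) (outerPoly p.2)),
    MvPolynomial.C t⁻¹ * shiftedInner (d + e) t p.1]

/-- The automorphism with components `familyCoord t p`. -/
noncomputable def familyAut {t : ℂ} (ht : t ≠ 0) (p : (Fin e → ℂ) × (Fin d → ℂ)) : PlaneAut ℂ :=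
  PlaneAut.triangular (inv_ne_zero (pow_ne_zero (d + e) ht)) (inv_ne_zero ht) 0 0 *
    (PlaneAut.triangular one_ne_zero one_ne_zero 0 (-outerPoly p.2) * PlaneAut.swap ℂ *
      PlaneAut.triangular one_ne_zero one_ne_zero 0 (innerPoly p.1)) *
    PlaneAut.triangular (pow_ne_zero (d + e) ht) ht 0 0

theorem familyAut_coord {t : ℂ} (ht : t ≠ 0) (p : (Fin e → ℂ) × (Fin d → ℂ)) :
    (familyAut ht p).coord = familyCoord t p := by
  funext i
  simp only [familyAut, PlaneAut.coord_mul]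
  fin_cases i
  · simp [familyCoord, shiftedInner, scaledInner, PlaneAut.triangular_coord,
      PlaneAut.swap_coord, PlaneAut.coord_mul, ← Polynomial.aeval_algHom_apply, sub_eq_add_neg]
  · simp [familyCoord, shiftedInner, scaledInner, PlaneAut.triangular_coord,
      PlaneAut.swap_coord, PlaneAut.coord_mul, ← Polynomial.aeval_algHom_apply]

theorem aeval_innerPoly (x : Fin e → ℂ) (v : MvPolynomial (Fin 2) ℂ) :
    Polynomial.aeval v (innerPoly x) = v + ∑ k, MvPolynomial.C (x k) * v ^ ((k : ℕ) + 2) := by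
  simp [innerPoly, MvPolynomial.algebraMap_eq]

theorem aeval_outerPoly (b : Fin d → ℂ) (v : MvPolynomial (Fin 2) ℂ) :
    Polynomial.aeval v (outerPoly b) = ∑ m, MvPolynomial.C (b m) * v ^ ((m : ℕ) + 1) := by
  simp [outerPoly, MvPolynomial.algebraMap_eq]

theorem CoeffTendsto.aeval_innerPoly {ι : Type*} {l : Filter ι} {x : ι → Fin e → ℂ}
    {x₀ : Fin e → ℂ} {v : ι → MvPolynomial (Fin 2) ℂ} {v₀ : MvPolynomial (Fin 2) ℂ}
    (hx : Tendsto x l (𝓝 x₀)) (hv : CoeffTendsto l v v₀) :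
    CoeffTendsto l (fun i => Polynomial.aeval (v i) (innerPoly (x i)))
      (Polynomial.aeval v₀ (innerPoly x₀)) := by
  simp only [_root_.aeval_innerPoly]
  exact hv.add (CoeffTendsto.sum _ fun k _ => (CoeffTendsto.C (tendsto_pi_nhds.1 hx k)).mul
    (hv.pow _))

theorem CoeffTendsto.aeval_outerPoly {ι : Type*} {l : Filter ι} {b : ι → Fin d → ℂ}
    {b₀ : Fin d → ℂ} {v : ι → MvPolynomial (Fin 2) ℂ} {v₀ : MvPolynomial (Fin 2) ℂ}
    (hb : Tendsto b l (𝓝 b₀)) (hv : CoeffTendsto l v v₀) :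
    CoeffTendsto l (fun i => Polynomial.aeval (v i) (outerPoly (b i)))
      (Polynomial.aeval v₀ (outerPoly b₀)) := by
  simp only [_root_.aeval_outerPoly]
  exact CoeffTendsto.sum _ fun k _ => (CoeffTendsto.C (tendsto_pi_nhds.1 hb k)).mul (hv.pow _)

theorem coeffTendsto_familyCoord {ι : Type*} {l : Filter ι} (t : ℂ)
    {p : ι → (Fin e → ℂ) × (Fin d → ℂ)} {p₀ : (Fin e → ℂ) × (Fin d → ℂ)}
    (hp : Tendsto p l (𝓝 p₀)) (k : Fin 2) :
    CoeffTendsto l (fun i => familyCoord t (p i) k) (familyCoord t p₀ k) := by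
  have hW := (CoeffTendsto.const (l := l)
    (MvPolynomial.C (t ^ (d + e)) * MvPolynomial.X 0)).add
      (CoeffTendsto.aeval_innerPoly ((continuous_fst.tendsto p₀).comp hp)
        (CoeffTendsto.const (MvPolynomial.C t * MvPolynomial.X 1)))
  fin_cases k
  · exact (CoeffTendsto.const _).mul ((CoeffTendsto.const _).sub
      (CoeffTendsto.aeval_outerPoly ((continuous_snd.tendsto p₀).comp hp) hW))
  · exact (CoeffTendsto.const _).mul hW

theorem PlaneAut.coeffTendsto_mul_mul {ι : Type*} {l : Filter ι}
    {P : ι → Fin 2 → MvPolynomial (Fin 2) ℂ} {θ : PlaneAut ℂ}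
    (hP : ∀ k, CoeffTendsto l (fun i => P i k) (θ.coord k)) (η ζ : PlaneAut ℂ) (k : Fin 2) :
    CoeffTendsto l (fun i => MvPolynomial.bind₁ ζ.coord (MvPolynomial.bind₁ (P i) (η.coord k)))
      ((η * θ * ζ).coord k) :=
  ((CoeffTendsto.const _).bind₁ hP).bind₁ fun _ => CoeffTendsto.const _

/-- When `xₑ` or `b_d` vanishes the factors drop in degree. Adding a small `ε ≠ 0` to every
parameter makes both leading coefficients nonzero, and the perturbed automorphisms converge back as
`ε → 0` with `t` fixed. -/
theorem mul_familyAut_mul_mem_closure (hd : 2 ≤ d) (he : 1 ≤ e) {t : ℂ} (ht : t ≠ 0)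
    (p : (Fin e → ℂ) × (Fin d → ℂ)) {η ζ : PlaneAut ℂ} (hη : η ∈ affineAuts ℂ)
    (hζ : ζ ∈ affineAuts ℂ) :
    η * familyAut ht p * ζ ∈ closure (polydegreeSet ℂ ![d, e + 1]) := by
  obtain ⟨e, rfl⟩ := Nat.exists_eq_add_of_le' he
  obtain ⟨d, rfl⟩ := Nat.exists_eq_add_of_le' (one_le_two.trans hd)
  have hp : Tendsto (fun ε : ℂ => ((fun k => p.1 k + ε, fun m => p.2 m + ε) :
      (Fin (e + 1) → ℂ) × (Fin (d + 1) → ℂ))) (𝓝[≠] 0) (𝓝 p) := by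
    refine Tendsto.mono_left ?_ nhdsWithin_le_nhds
    have : Continuous (fun ε : ℂ => ((fun k => p.1 k + ε, fun m => p.2 m + ε) :
      (Fin (e + 1) → ℂ) × (Fin (d + 1) → ℂ))) := by fun_prop
    simpa using this.tendsto 0
  refine PlaneAut.mem_closure_of_coeffTendsto (l := 𝓝[≠] (0 : ℂ))
    (PlaneAut.coeffTendsto_mul_mul (fun k => ?_) η ζ)
    (P := fun ε k => MvPolynomial.bind₁ ζ.coord (MvPolynomial.bind₁
      (familyCoord t (fun k => p.1 k + ε, fun m => p.2 m + ε)) (η.coord k))) ?_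
  · rw [familyAut_coord]
    exact coeffTendsto_familyCoord t hp k
  · have hne : ∀ z : ℂ, ∀ᶠ ε in 𝓝[≠] (0 : ℂ), z + ε ≠ 0 := fun z => by
      rcases eq_or_ne z 0 with rfl | hz
      · filter_upwards [self_mem_nhdsWithin] with ε hε
        simpa using hε
      · refine Filter.Eventually.filter_mono nhdsWithin_le_nhds ?_
        have : ContinuousAt (fun ε : ℂ => z + ε) 0 := by fun_prop
        exact this.eventually_ne (by simpa using hz)
    filter_upwards [hne (p.1 (Fin.last e)), hne (p.2 (Fin.last d))] with ε hx hb
    refine ⟨η * familyAut ht (fun k => p.1 k + ε, fun m => p.2 m + ε) * ζ, ?_, ?_⟩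
    · have := PlaneAut.mul_mem_polydegreeSet
        (PlaneAut.mul_mem_affineAuts hη (PlaneAut.triangular_mem_affineAuts
          (inv_ne_zero (pow_ne_zero (d + 1 + (e + 1)) ht)) (inv_ne_zero ht) 0 (P := 0) (by simp)))
        (PlaneAut.mul_mem_affineAuts (PlaneAut.triangular_mem_affineAuts
          (pow_ne_zero (d + 1 + (e + 1)) ht) ht 0 (P := 0) (by simp)) hζ)
        (P := -outerPoly fun m => p.2 m + ε) (Q := innerPoly fun k => p.1 k + ε)
        ((Polynomial.natDegree_neg _).trans (natDegree_outerPoly _ hb))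
        (natDegree_innerPoly _ hx) hd (by omega)
      simpa only [familyAut, mul_assoc] using this
    · funext k
      rw [PlaneAut.coord_mul, PlaneAut.coord_mul, familyAut_coord]

end Family

/-! ### The limit as `t` tends to zero -/

section Limit

variable {d e : ℕ}

/-- The first component of `familyCoord t p` for `t ≠ 0`, with the powers of `t` cancelled. -/
noncomputable def regularFst (t : ℂ) (p : (Fin e → ℂ) × (Fin d → ℂ)) : MvPolynomial (Fin 2) ℂ :=
  -- The range covers both the degree bound `d (e + 1)` of `G ∘ f` and the bound `d + e` for `P`, so
  -- the family and its limit are expanded over the same indices.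
  ∑ j ∈ Finset.range (d * (e + 1) + (d + e) + 1), MvPolynomial.C
      ((Polynomial.X - (outerPoly p.2).comp (innerPoly p.1)).coeff j * t ^ j / t ^ (d + e)) *
        MvPolynomial.X 1 ^ j -
    MvPolynomial.X 0 * ∑ m, MvPolynomial.C (p.2 m) * ∑ i ∈ Finset.range ((m : ℕ) + 1),
      shiftedInner (d + e) t p.1 ^ i * scaledInner t p.1 ^ ((m : ℕ) - i)

/-- The second component of `familyCoord t p` for `t ≠ 0`, with the powers of `t` cancelled. -/
noncomputable def regularSnd (t : ℂ) (p : (Fin e → ℂ) × (Fin d → ℂ)) : MvPolynomial (Fin 2) ℂ :=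
  MvPolynomial.C (t ^ (d + e - 1)) * MvPolynomial.X 0 + MvPolynomial.X 1 +
    ∑ k, MvPolynomial.C (p.1 k * t ^ ((k : ℕ) + 1)) * MvPolynomial.X 1 ^ ((k : ℕ) + 2)

theorem C_inv_mul_C {z : ℂ} (hz : z ≠ 0) :
    (MvPolynomial.C z⁻¹ : MvPolynomial (Fin 2) ℂ) * MvPolynomial.C z = 1 := by
  rw [← MvPolynomial.C_mul, inv_mul_cancel₀ hz, MvPolynomial.C_1]

/-- Write `W = V + tᴺ X` with `V = f(tY)`. Then `G(W) - G(V)` is divisible by `W - V = tᴺ X`, which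
cancels the prefactor `t⁻ᴺ`; the remainder `tY - G(V)` is a polynomial in `tY`. -/
theorem familyCoord_zero_eq_regularFst (hd : 1 ≤ d) {t : ℂ} (ht : t ≠ 0)
    (p : (Fin e → ℂ) × (Fin d → ℂ)) : familyCoord t p 0 = regularFst t p := by
  have h1 : Polynomial.aeval (shiftedInner (d + e) t p.1) (outerPoly p.2) -
      Polynomial.aeval (scaledInner t p.1) (outerPoly p.2) =
      MvPolynomial.C (t ^ (d + e)) * (MvPolynomial.X 0 * ∑ m, MvPolynomial.C (p.2 m) *
        ∑ i ∈ Finset.range ((m : ℕ) + 1),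
          shiftedInner (d + e) t p.1 ^ i * scaledInner t p.1 ^ ((m : ℕ) - i)) := by
    rw [aeval_outerPoly, aeval_outerPoly, ← Finset.sum_sub_distrib, Finset.mul_sum,
      Finset.mul_sum]
    refine Finset.sum_congr rfl fun m _ => ?_
    have h := (Commute.all (shiftedInner (d + e) t p.1) (scaledInner t p.1)).geom_sum₂_mul
      ((m : ℕ) + 1)
    simp only [Nat.add_sub_cancel] at h
    have h' : shiftedInner (d + e) t p.1 - scaledInner t p.1 =
        MvPolynomial.C (t ^ (d + e)) * MvPolynomial.X 0 := by
      rw [shiftedInner, add_sub_cancel_right]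
    rw [← mul_sub, ← h, h']
    ring
  have h2 : MvPolynomial.C t * MvPolynomial.X 1 -
      Polynomial.aeval (scaledInner t p.1) (outerPoly p.2) =
      MvPolynomial.C (t ^ (d + e)) * ∑ j ∈ Finset.range (d * (e + 1) + (d + e) + 1),
        MvPolynomial.C ((Polynomial.X - (outerPoly p.2).comp (innerPoly p.1)).coeff j * t ^ j /
          t ^ (d + e)) * MvPolynomial.X 1 ^ j := by
    have hdeg : (Polynomial.X - (outerPoly p.2).comp (innerPoly p.1)).natDegree <
        d * (e + 1) + (d + e) + 1 := by
      refine Nat.lt_succ_of_le ((Polynomial.natDegree_sub_le _ _).trans (max_le ?_ ?_))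
      · rw [Polynomial.natDegree_X]
        omega
      · rw [Polynomial.natDegree_comp]
        exact (Nat.mul_le_mul (natDegree_outerPoly_le _) (natDegree_innerPoly_le _)).trans
          (Nat.le_add_right _ _)
    have h3 : MvPolynomial.C t * MvPolynomial.X 1 -
        Polynomial.aeval (scaledInner t p.1) (outerPoly p.2) =
        Polynomial.aeval (MvPolynomial.C t * MvPolynomial.X 1 : MvPolynomial (Fin 2) ℂ)
          (Polynomial.X - (outerPoly p.2).comp (innerPoly p.1)) := by
      rw [map_sub, Polynomial.aeval_X, Polynomial.aeval_comp, scaledInner]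
    rw [h3, Polynomial.aeval_eq_sum_range' hdeg, Finset.mul_sum]
    refine Finset.sum_congr rfl fun j _ => ?_
    rw [MvPolynomial.smul_eq_C_mul, mul_pow, ← mul_assoc, ← mul_assoc, ← MvPolynomial.C_pow,
      ← MvPolynomial.C_mul, ← MvPolynomial.C_mul, mul_div_cancel₀ _ (pow_ne_zero _ ht)]
  have h4 := C_inv_mul_C (pow_ne_zero (d + e) ht)
  change MvPolynomial.C (t ^ (d + e))⁻¹ * (MvPolynomial.C t * MvPolynomial.X 1 -
      Polynomial.aeval (shiftedInner (d + e) t p.1) (outerPoly p.2)) = _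
  rw [← sub_add_sub_cancel _ (Polynomial.aeval (scaledInner t p.1) (outerPoly p.2)), h2,
    ← neg_sub (Polynomial.aeval (shiftedInner (d + e) t p.1) (outerPoly p.2)), h1, ← sub_eq_add_neg,
    ← mul_sub, ← mul_assoc, h4, one_mul, regularFst]

theorem familyCoord_one_eq_regularSnd (hd : 1 ≤ d) {t : ℂ} (ht : t ≠ 0)
    (p : (Fin e → ℂ) × (Fin d → ℂ)) : familyCoord t p 1 = regularSnd t p := by
  have h1 := C_inv_mul_C ht
  have h2 : (MvPolynomial.C t⁻¹ : MvPolynomial (Fin 2) ℂ) * MvPolynomial.C (t ^ (d + e)) =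
      MvPolynomial.C (t ^ (d + e - 1)) := by
    obtain ⟨n, hn⟩ := Nat.exists_eq_add_of_le' (Nat.le_add_right_of_le hd : 1 ≤ d + e)
    rw [← MvPolynomial.C_mul, hn, pow_succ', inv_mul_cancel_left₀ ht, Nat.add_sub_cancel]
  change MvPolynomial.C t⁻¹ * shiftedInner (d + e) t p.1 = _
  rw [shiftedInner, scaledInner, regularSnd, aeval_innerPoly, mul_add, mul_add, ← mul_assoc,
    ← mul_assoc, h1, h2, one_mul, Finset.mul_sum, add_assoc]
  congr 2
  refine Finset.sum_congr rfl fun k _ => ?_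
  rw [MvPolynomial.C_mul, MvPolynomial.C_pow]
  linear_combination MvPolynomial.C (p.1 k) * MvPolynomial.C t ^ ((k : ℕ) + 1) *
    MvPolynomial.X 1 ^ ((k : ℕ) + 2) * h1

theorem familyCoord_eq (hd : 1 ≤ d) {t : ℂ} (ht : t ≠ 0) (p : (Fin e → ℂ) × (Fin d → ℂ)) :
    familyCoord t p = ![regularFst t p, regularSnd t p] := by
  funext i
  fin_cases i
  · exact familyCoord_zero_eq_regularFst hd ht p
  · exact familyCoord_one_eq_regularSnd hd ht p

theorem continuous_coeff_comp (j : ℕ) : Continuous fun p : (Fin e → ℂ) × (Fin d → ℂ) =>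
    ((outerPoly p.2).comp (innerPoly p.1)).coeff j := by
  simp only [← Polynomial.coeff_coe, coe_outerPoly_comp_innerPoly]
  refine continuous_iff_continuousAt.2 fun a => ?_
  obtain ⟨L, -, hL⟩ := PowerSeries.hasCoeffDerivAt_compSeries a j
  exact hL.continuousAt

theorem tendsto_pow_punctured_nhds_zero {n : ℕ} (hn : n ≠ 0) :
    Tendsto (fun t : ℂ => t ^ n) (𝓝[≠] 0) (𝓝 0) := by
  have ht : Tendsto (fun t : ℂ => t) (𝓝[≠] 0) (𝓝 0) := nhdsWithin_le_nhds
  simpa [hn] using ht.pow n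

theorem coeffTendsto_regularSnd (h : 2 ≤ d + e) {s : ℂ → (Fin e → ℂ) × (Fin d → ℂ)}
    {a : (Fin e → ℂ) × (Fin d → ℂ)} (hs : Tendsto s (𝓝[≠] 0) (𝓝 a)) :
    CoeffTendsto (𝓝[≠] 0) (fun t => regularSnd t (s t)) (MvPolynomial.X 1) := by
  have hx : Tendsto (fun t => (s t).1) (𝓝[≠] 0) (𝓝 a.1) := (continuous_fst.tendsto a).comp hs
  have h1 := (((CoeffTendsto.C (tendsto_pow_punctured_nhds_zero
    (show d + e - 1 ≠ 0 by omega))).mul (CoeffTendsto.const (MvPolynomial.X 0))).add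
      (CoeffTendsto.const (MvPolynomial.X 1))).add
      (CoeffTendsto.sum Finset.univ fun (k : Fin e) _ =>
        (CoeffTendsto.C ((tendsto_pi_nhds.1 hx k).mul
          (tendsto_pow_punctured_nhds_zero (Nat.succ_ne_zero (k : ℕ))))).mul
          (CoeffTendsto.const (MvPolynomial.X 1 ^ ((k : ℕ) + 2))))
  have h2 : (MvPolynomial.C 0 * MvPolynomial.X 0 + MvPolynomial.X 1 +
      ∑ k : Fin e, MvPolynomial.C (a.1 k * 0) * MvPolynomial.X 1 ^ ((k : ℕ) + 2) :
        MvPolynomial (Fin 2) ℂ) = MvPolynomial.X 1 := by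
    simp
  rw [h2] at h1
  exact h1

/-- In degrees `1 ≤ j ≤ N` the equations `hsol` make the coefficient of `Yʲ` in the first sum equal
to that of `P`. Beyond `N` a positive power of `t` multiplies a convergent coefficient. In the
multiple of `X`, the arguments `V` and `W` tend to zero, so only the linear coefficient of `G`, with
limit one, survives. -/
theorem coeffTendsto_regularFst (hd : 1 ≤ d) {s : ℂ → (Fin e → ℂ) × (Fin d → ℂ)}
    {a : (Fin e → ℂ) × (Fin d → ℂ)} (hs : Tendsto s (𝓝[≠] 0) (𝓝 a)) (ha : a.2 ⟨0, hd⟩ = 1)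
    {P : Polynomial ℂ} (hP : P.natDegree ≤ d + e) (hP0 : P.coeff 0 = 0)
    (hsol : ∀ᶠ t in 𝓝[≠] (0 : ℂ), ∀ j : Fin (d + e), PowerSeries.compCoeffs (s t) j =
      (if (j : ℕ) = 0 then 1 else 0) - t ^ (d + e - (j + 1)) * P.coeff (j + 1)) :
    CoeffTendsto (𝓝[≠] 0) (fun t => regularFst t (s t))
      (Polynomial.aeval (MvPolynomial.X 1) P - MvPolynomial.X 0) := by
  have ht : Tendsto (fun t : ℂ => t) (𝓝[≠] 0) (𝓝 0) := nhdsWithin_le_nhds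
  have hx : Tendsto (fun t => (s t).1) (𝓝[≠] 0) (𝓝 a.1) := (continuous_fst.tendsto a).comp hs
  have hb : Tendsto (fun t => (s t).2) (𝓝[≠] 0) (𝓝 a.2) := (continuous_snd.tendsto a).comp hs
  have hv : CoeffTendsto (𝓝[≠] (0 : ℂ)) (fun t => scaledInner t (s t).1) 0 := by
    have h := CoeffTendsto.aeval_innerPoly hx ((CoeffTendsto.C ht).mul
      (CoeffTendsto.const (MvPolynomial.X 1)))
    have h0 : Polynomial.aeval (MvPolynomial.C 0 * MvPolynomial.X 1 : MvPolynomial (Fin 2) ℂ)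
        (innerPoly a.1) = 0 := by
      simp [aeval_innerPoly]
    rwa [h0] at h
  have hW : CoeffTendsto (𝓝[≠] (0 : ℂ)) (fun t => shiftedInner (d + e) t (s t).1) 0 := by
    have h := ((CoeffTendsto.C (tendsto_pow_punctured_nhds_zero
      (show d + e ≠ 0 by omega))).mul (CoeffTendsto.const (MvPolynomial.X 0))).add hv
    rw [MvPolynomial.C_0, zero_mul, zero_add] at h
    exact h
  have hcoeff : ∀ j, Tendsto (fun t =>
      (Polynomial.X - (outerPoly (s t).2).comp (innerPoly (s t).1)).coeff j * t ^ j /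
        t ^ (d + e)) (𝓝[≠] 0) (𝓝 (P.coeff j)) := by
    intro j
    rcases lt_or_ge (d + e) j with hj | hj
    · rw [Polynomial.coeff_eq_zero_of_natDegree_lt (hP.trans_lt hj)]
      have hc : Tendsto (fun t => ((Polynomial.X : Polynomial ℂ).coeff j -
          ((outerPoly (s t).2).comp (innerPoly (s t).1)).coeff j) * t ^ (j - (d + e)))
          (𝓝[≠] 0) (𝓝 0) := by
        have h := ((((continuous_coeff_comp j).tendsto a).comp hs).const_sub
          ((Polynomial.X : Polynomial ℂ).coeff j)).mul
            (tendsto_pow_punctured_nhds_zero (show j - (d + e) ≠ 0 by omega))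
        rw [mul_zero] at h
        exact h
      refine hc.congr' ?_
      filter_upwards [self_mem_nhdsWithin] with t ht0
      obtain ⟨i, rfl⟩ := Nat.exists_eq_add_of_le hj.le
      have ht0 : t ≠ 0 := ht0
      rw [Polynomial.coeff_sub, Nat.add_sub_cancel_left, pow_add]
      field_simp
    · refine tendsto_const_nhds.congr' ?_
      filter_upwards [self_mem_nhdsWithin, hsol] with t ht0 hsolt
      have ht0 : t ≠ 0 := ht0
      rw [Polynomial.coeff_sub, ← Polynomial.coeff_coe ((outerPoly (s t).2).comp _),
        coe_outerPoly_comp_innerPoly]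
      rcases j with _ | j
      · have h0 : PowerSeries.coeff 0 (PowerSeries.compSeries (s t)) = 0 := by
          rw [PowerSeries.coeff_zero_eq_constantCoeff_apply, ← PowerSeries.X_dvd_iff]
          exact PowerSeries.X_dvd_sum_C_mul_X_mul_pow _ _
        rw [h0, hP0]
        simp
      · have hj' : PowerSeries.coeff (j + 1) (PowerSeries.compSeries (s t)) =
            (if j = 0 then 1 else 0) - t ^ (d + e - (j + 1)) * P.coeff (j + 1) :=
          hsolt ⟨j, hj⟩
        have hite : (if 1 = j + 1 then (1 : ℂ) else 0) = if j = 0 then 1 else 0 := by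
          simp
        have hpow : t ^ (d + e) = t ^ (d + e - (j + 1)) * t ^ (j + 1) := by
          rw [← pow_add, Nat.sub_add_cancel hj]
        rw [hj', Polynomial.coeff_X, hite, sub_sub_cancel, hpow]
        field_simp
  have h1 := CoeffTendsto.sum (l := 𝓝[≠] (0 : ℂ)) (Finset.range (d * (e + 1) + (d + e) + 1))
    fun j _ => (CoeffTendsto.C (hcoeff j)).mul (CoeffTendsto.const (MvPolynomial.X 1 ^ j))
  have h2 := (CoeffTendsto.const (l := 𝓝[≠] (0 : ℂ)) (MvPolynomial.X 0)).mul
    (CoeffTendsto.sum Finset.univ fun (m : Fin d) _ =>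
      (CoeffTendsto.C (tendsto_pi_nhds.1 hb m)).mul
        (CoeffTendsto.sum (Finset.range ((m : ℕ) + 1)) fun i _ =>
          (hW.pow i).mul (hv.pow ((m : ℕ) - i))))
  -- Only the term with both exponents zero contributes, by `0 ^ 0 = 1`; it occurs exactly for `m =
  -- 0`.
  have h3 : ∀ m : Fin d, ∑ i ∈ Finset.range ((m : ℕ) + 1),
      (0 : MvPolynomial (Fin 2) ℂ) ^ i * 0 ^ ((m : ℕ) - i) = if m = ⟨0, hd⟩ then 1 else 0 := by
    intro m
    split_ifs with hm
    · simp [hm]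
    · have hm' : (m : ℕ) ≠ 0 := fun h => hm (Fin.ext h)
      refine Finset.sum_eq_zero fun i _ => ?_
      rw [← pow_add]
      exact zero_pow (by omega)
  have h4 : (∑ m : Fin d, MvPolynomial.C (a.2 m) * ∑ i ∈ Finset.range ((m : ℕ) + 1),
      (0 : MvPolynomial (Fin 2) ℂ) ^ i * 0 ^ ((m : ℕ) - i)) = 1 := by
    simp only [h3, mul_ite, mul_one, mul_zero, Finset.sum_ite_eq', Finset.mem_univ, if_true, ha,
      MvPolynomial.C_1]
  have h5 := h1.sub h2
  rw [h4, mul_one] at h5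
  rw [Polynomial.aeval_eq_sum_range' (n := d * (e + 1) + (d + e) + 1) (by omega)]
  simp only [MvPolynomial.smul_eq_C_mul]
  exact h5

theorem coeffTendsto_regular (hd : 1 ≤ d) (he : 1 ≤ e) {s : ℂ → (Fin e → ℂ) × (Fin d → ℂ)}
    {a : (Fin e → ℂ) × (Fin d → ℂ)} (hs : Tendsto s (𝓝[≠] 0) (𝓝 a)) (ha : a.2 ⟨0, hd⟩ = 1)
    {P : Polynomial ℂ} (hP : P.natDegree ≤ d + e) (hP0 : P.coeff 0 = 0)
    (hsol : ∀ᶠ t in 𝓝[≠] (0 : ℂ), ∀ j : Fin (d + e), PowerSeries.compCoeffs (s t) j =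
      (if (j : ℕ) = 0 then 1 else 0) - t ^ (d + e - (j + 1)) * P.coeff (j + 1)) (k : Fin 2) :
    CoeffTendsto (𝓝[≠] 0) (fun t => (![regularFst t (s t), regularSnd t (s t)] :
      Fin 2 → MvPolynomial (Fin 2) ℂ) k)
      ((PlaneAut.triangular (neg_ne_zero.2 one_ne_zero) one_ne_zero 0 P).coord k) := by
  have hcoord : (PlaneAut.triangular (neg_ne_zero.2 (one_ne_zero (α := ℂ))) one_ne_zero 0 P).coord =
      ![Polynomial.aeval (MvPolynomial.X 1) P - MvPolynomial.X 0, MvPolynomial.X 1] := by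
    funext i
    fin_cases i
    · simp [PlaneAut.triangular_coord, sub_eq_neg_add]
    · simp [PlaneAut.triangular_coord]
  rw [hcoord]
  fin_cases k
  · exact coeffTendsto_regularFst hd hs ha hP hP0 hsol
  · exact coeffTendsto_regularSnd (by omega) hs

end Limit

/-! ### Solving the congruence and conclusion -/

/-- For a polynomial `P` of degree `d + e` with leading coefficient `g_{d+e-1}` and without constant
term, the congruence `G(f(X)) ≡ X - t ^ (d + e) P(X / t)` modulo `X ^ (d + e + 1)` has a solution
that depends continuously on `t` near `0`. -/
theorem exists_tendsto_compCoeffs_family {d e : ℕ} (he : 1 ≤ e) (x : Fin e → ℂ) {g : ℕ → ℂ}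
    (hg : ∀ n : ℕ, ((n : ℂ) + 1) * g n =
      PowerSeries.coeff n ((PowerSeries.unitSeries x)⁻¹ ^ (n + 1)))
    (hg0 : ∀ i, i + 2 ≤ e → g (d + i) = 0)
    (hdet : (PowerSeries.alphaMatrix (PowerSeries.unitSeries x) d e).det ≠ 0)
    {P : Polynomial ℂ} (hP : P.coeff (d + e) = g (d + e - 1)) :
    ∃ s : ℂ → (Fin e → ℂ) × (Fin d → ℂ), Tendsto s (𝓝[≠] 0) (𝓝 (x, fun m => g m)) ∧
      ∀ᶠ t in 𝓝[≠] (0 : ℂ), ∀ j : Fin (d + e), PowerSeries.compCoeffs (s t) j =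
        (if (j : ℕ) = 0 then 1 else 0) - t ^ (d + e - (j + 1)) * P.coeff (j + 1) := by
  set a : (Fin e → ℂ) × (Fin d → ℂ) := (x, fun m => g m) with ha
  have hdvd : (PowerSeries.X : PowerSeries ℂ) ^ (d + e + 1) ∣ PowerSeries.compSeries a -
      (PowerSeries.X - PowerSeries.C (g (d + e - 1)) * PowerSeries.X ^ (d + e)) :=
    PowerSeries.X_pow_dvd_sum_sub (PowerSeries.constantCoeff_unitSeries x) he hg hg0
  have hdvd' : (PowerSeries.X : PowerSeries ℂ) ^ (d + e) ∣
      PowerSeries.compSeries a - PowerSeries.X := by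
    have h := dvd_sub ((pow_dvd_pow _ (Nat.le_succ _)).trans hdvd)
      (dvd_mul_left (PowerSeries.X ^ (d + e)) (PowerSeries.C (g (d + e - 1))))
    rwa [← sub_add, add_sub_cancel_right] at h
  obtain ⟨s, hs, hsol⟩ := PowerSeries.exists_tendsto_compCoeffs_eq a hdet hdvd'
  set c : ℂ → Fin (d + e) → ℂ := fun t j =>
    (if (j : ℕ) = 0 then 1 else 0) - t ^ (d + e - (j + 1)) * P.coeff (j + 1) with hc
  -- At `t = 0` only the term with exponent zero of `t` remains, in degree `d + e`. There the
  -- normalisation `hP` makes it agree with the error term of the truncated inverse.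
  have hca : c 0 = PowerSeries.compCoeffs a := by
    funext j
    have h1 := PowerSeries.X_pow_dvd_iff.1 hdvd (j + 1) (by omega)
    rw [map_sub, sub_eq_zero] at h1
    rw [PowerSeries.compCoeffs, h1, map_sub, PowerSeries.coeff_X, PowerSeries.coeff_C_mul,
      PowerSeries.coeff_X_pow]
    simp only [hc, Nat.add_eq_right]
    congr 1
    by_cases hj : (j : ℕ) + 1 = d + e
    · rw [hj, hP, Nat.sub_self, pow_zero, one_mul, if_pos rfl, mul_one]
    · rw [if_neg hj, zero_pow (by omega), zero_mul, mul_zero]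
  have hclim : Tendsto c (𝓝[≠] 0) (𝓝 (PowerSeries.compCoeffs a)) := by
    have hcont : Continuous c := by fun_prop
    rw [← hca]
    exact (hcont.tendsto 0).mono_left nhdsWithin_le_nhds
  exact ⟨fun t => s (c t), hs.comp hclim, (hclim.eventually hsol).mono fun t ht j => congrFun ht j⟩

theorem theorem2 (d e : ℕ) (hd : 2 ≤ d) (he : 1 ≤ e)
    (h : ∃ ψ : MvPolynomial (Fin e) ℂ →ₐ[ℂ] ℂ,
      (∀ i : ℕ, i + 2 ≤ e → ψ (gPoly ℂ (d + i) e) = 0) ∧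
      ψ (gPoly ℂ (d + e - 1) e) ≠ 0 ∧
      ψ (aPoly ℂ d e) ≠ 0) :
    polydegreeSet ℂ ![d + e] ⊆ closure (polydegreeSet ℂ ![d, e + 1]) := by
  obtain ⟨ψ, hg0, hgN, hdet⟩ := h
  intro θ hθ
  -- The nonvanishing of `g_{d+e-1}` allows it to be prescribed as the leading coefficient of `P`.
  obtain ⟨η, hη, ζ, hζ, P, hPdeg, hPN, hP0, rfl⟩ :=
    PlaneAut.exists_eq_of_mem_polydegreeSet_singleton (by omega) hθ hgN
  obtain ⟨x, rfl⟩ : ∃ x : Fin e → ℂ, ψ = MvPolynomial.aeval x :=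
    ⟨fun k => ψ (MvPolynomial.X k), MvPolynomial.aeval_unique ψ⟩
  rw [PowerSeries.aeval_aPoly x (by omega)] at hdet
  have hg : ∀ n : ℕ, ((n : ℂ) + 1) * MvPolynomial.aeval x (gPoly ℂ n e) =
      PowerSeries.coeff n ((PowerSeries.unitSeries x)⁻¹ ^ (n + 1)) := fun n => by
    rw [PowerSeries.aeval_gPoly, ← mul_assoc,
      mul_one_div_cancel (by exact_mod_cast Nat.succ_ne_zero n), one_mul]
  have hg1 : MvPolynomial.aeval x (gPoly ℂ 0 e) = 1 := by
    simpa [PowerSeries.constantCoeff_unitSeries] using hg 0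
  obtain ⟨s, hs, hsol⟩ := exists_tendsto_compCoeffs_family he x hg hg0 hdet hPN
  have hlim := coeffTendsto_regular (by omega) he hs hg1 hPdeg hP0 hsol
  -- The approximating automorphisms are themselves only known to lie in the closure, so the limit
  -- is taken in the closure of the closure.
  rw [← isClosed_closure.closure_eq]
  refine PlaneAut.mem_closure_of_coeffTendsto (PlaneAut.coeffTendsto_mul_mul hlim η ζ)
    (P := fun t k => MvPolynomial.bind₁ ζ.coord (MvPolynomial.bind₁
      ![regularFst t (s t), regularSnd t (s t)] (η.coord k))) ?_
  filter_upwards [self_mem_nhdsWithin] with t ht0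
  have ht : t ≠ 0 := ht0
  refine ⟨_, mul_familyAut_mul_mem_closure hd he ht (s t) hη hζ, funext fun k => ?_⟩
  rw [PlaneAut.coord_mul, PlaneAut.coord_mul, familyAut_coord, familyCoord_eq (by omega) ht]
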